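/- **Problems.** Consider instances consisting of a degree $n$, a list of permutations in $S_n$ generating a group $G\le S_n$, a function $f$ on $G$, and the promise that $f$ hides some subgroup $H\le G$: $f$ is constant on each left coset of $H$ and takes distinct values on distinct left cosets. (Alternatively, use right cosets throughout; the result is claimed for each of the two conventions.) The function $f$ is given by a program, which may call an arbitrary black box $\varphi$ (and may consist of a single such call), together with a time bound in unary within which it halts on every element of $G$; degree and points are written in unary. * $\textsc{Hidden Subgroup}_D$ over permutation groups: decide whether $H$ is nontrivial. * $\textsc{Hidden Subgroup}_S$ over permutation groups: output a nontrivial element of $H$ if there is one, and report that there is none otherwise. **Reductions.** A problem $A$ is polynomial-time truth-table (nonadaptively) reducible to $B$ if there are two polynomial-time programs $Q$ and $E$, independent of $\varphi$, such that for every $\varphi$ and every instance $x$ of $A$ satisfying its promise, $Q$ computes from $x$ a list of instances of $B$, all satisfying the promise of $B$, and $E$ computes a correct answer to $x$ from $x$ and any list of correct answers to these instances. Running times are bounded by a fixed polynomial in the length of the input of the respective program. Machines work on binary trees and are charged for the size of the data they read and write, which agrees with Turing machine time up to a polynomial. **Corollary.** Over permutation groups, $\textsc{Hidden Subgroup}_D$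 and $\textsc{Hidden Subgroup}_S$ are polynomial-time equivalent: each is reducible to the other by a polynomial-time truth-table reduction (so, in particular, by a polynomial-time Turing reduction). -/

import Mathlib

namespace HSP

/-! ### Data and a step-counting machine model

Data are binary trees, as in LISP or in the WHILE language. -/

/-- Binary trees: the words on which programs work. -/
inductive Data where
  | nil : Data
  | cons : Data → Data → Data
  deriving DecidableEq

namespace Data

/-- The number of nodes of a tree; this is the length of an input. -/
def size : Data → ℕ
  | nil => 1
  | cons a b => size a + size b + 1

/-- First component (`nil` for `nil`). -/
def hd : Data → Data
  | nil => nil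
  | cons a _ => a

/-- Second component (`nil` for `nil`). -/
def tl : Data → Data
  | nil => nil
  | cons _ b => b

/-- The truth value "true"; the truth value "false" is `nil`. -/
def yes : Data := cons nil nil

/-- Comparison of the two components. -/
def eqTest : Data → Data
  | nil => nil
  | cons a b => if a = b then yes else nil

/-- Lists of trees as trees. -/
def ofList : List Data → Data
  | [] => nil
  | a :: l => cons a (ofList l)

/-- Natural numbers in unary. -/
def ofNat : ℕ → Data
  | 0 => nil
  | k + 1 => cons nil (ofNat k)

/-- A permutation of degree `n` is written as the list of its values. -/
def ofPerm {n : ℕ} (g : Equiv.Perm (Fin n)) : Data :=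
  ofList (List.ofFn fun i => ofNat (g i : ℕ))

end Data

/-- A black box (oracle) which programs may call. -/
abbrev BlackBox := Data → Data

/-- Programs: each one acts on one tree and, if it halts, returns one tree. -/
inductive Prog where
  /-- return the input -/
  | id : Prog
  /-- return `nil` -/
  | nil : Prog
  /-- return the first component -/
  | hd : Prog
  /-- return the second component -/
  | tl : Prog
  /-- compare the two components of the input -/
  | eq : Prog
  /-- call the black box on the input -/
  | call : Prog
  /-- run both programs on the input and pair their results -/
  | pair : Prog → Prog → Prog
  /-- run the first program, then run the second one on its result -/
  | comp : Prog → Prog → Prog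
  /-- if the first program does not return `nil`, run the second program on the input,
  otherwise the third -/
  | ite : Prog → Prog → Prog → Prog
  /-- while the first program does not return `nil` on the current value, replace this value
  by the result of the second program on it -/
  | loop : Prog → Prog → Prog

/-- The text of a program, as a tree. -/
def Prog.toData : Prog → Data
  | .id => .cons (.ofNat 0) .nil
  | .nil => .cons (.ofNat 1) .nil
  | .hd => .cons (.ofNat 2) .nil
  | .tl => .cons (.ofNat 3) .nil
  | .eq => .cons (.ofNat 4) .nil
  | .call => .cons (.ofNat 5) .nil
  | .pair p q => .cons (.ofNat 6) (.cons p.toData q.toData)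
  | .comp p q => .cons (.ofNat 7) (.cons p.toData q.toData)
  | .ite c p q => .cons (.ofNat 8) (.cons c.toData (.cons p.toData q.toData))
  | .loop c p => .cons (.ofNat 9) (.cons c.toData p.toData)

/-- `Run φ p x y t`: with black box `φ`, the program `p` halts on input `x` with output `y`
after `t` steps. A basic instruction is charged for reading its whole input and for writing its
whole output, so all trees that occur in a run of cost `t` have size at most `t`, and time
agrees with Turing machine time up to a polynomial. -/
inductive Run (φ : BlackBox) : Prog → Data → Data → ℕ → Prop where
  | id (x : Data) : Run φ .id x x (x.size + x.size + 1)
  | nil (x : Data) : Run φ .nil x .nil (x.size + Data.nil.size + 1)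
  | hd (x : Data) : Run φ .hd x x.hd (x.size + x.hd.size + 1)
  | tl (x : Data) : Run φ .tl x x.tl (x.size + x.tl.size + 1)
  | eq (x : Data) : Run φ .eq x x.eqTest (x.size + x.eqTest.size + 1)
  | call (x : Data) : Run φ .call x (φ x) (x.size + (φ x).size + 1)
  | pair {p q : Prog} {x y z : Data} {s t : ℕ} :
      Run φ p x y s → Run φ q x z t → Run φ (.pair p q) x (.cons y z) (s + t + 1)
  | comp {p q : Prog} {x y z : Data} {s t : ℕ} :
      Run φ p x y s → Run φ q y z t → Run φ (.comp p q) x z (s + t + 1)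
  | iteTrue {c p q : Prog} {x a b y : Data} {s t : ℕ} :
      Run φ c x (.cons a b) s → Run φ p x y t → Run φ (.ite c p q) x y (s + t + 1)
  | iteFalse {c p q : Prog} {x y : Data} {s t : ℕ} :
      Run φ c x .nil s → Run φ q x y t → Run φ (.ite c p q) x y (s + t + 1)
  | loopStop {c p : Prog} {x : Data} {s : ℕ} :
      Run φ c x .nil s → Run φ (.loop c p) x x (s + 1)
  | loopStep {c p : Prog} {x a b y z : Data} {s t u : ℕ} :
      Run φ c x (.cons a b) s → Run φ p x y t → Run φ (.loop c p) y z u →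
      Run φ (.loop c p) x z (s + t + u + 1)

/-- With black box `φ`, the program `p` maps `x` to `y` in at most `T` steps. -/
def RunsWithin (φ : BlackBox) (p : Prog) (x y : Data) (T : ℕ) : Prop :=
  ∃ t ≤ T, Run φ p x y t

/-! ### Promise problems and reductions -/

/-- A decision or search problem with a promise. An instance may refer to the black box, so the
promise and the correct answers depend on it. Answers are trees. -/
structure Problem where
  /-- the (syntactic) instances -/
  Instance : Type
  /-- how instances are written as inputs -/
  encode : Instance → Data
  /-- the promise -/
  Promise : BlackBox → Instance → Prop
  /-- the correct answers -/
  IsAnswer : BlackBox → Instance → Data → Prop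

/-- Polynomial-time truth-table (that is, nonadaptive) reducibility of `A` to `B`. One
polynomial-time program `Q` maps an instance `x` of `A` to a list of queries, all of them
instances of `B` that satisfy the promise of `B`; a second polynomial-time program `E` computes a
correct answer for `x` from `x` and any list of correct answers to the queries. -/
def TruthTableReducible (A B : Problem) : Prop :=
  ∃ (Q E : Prog) (P : Polynomial ℕ), ∀ (φ : BlackBox) (x : A.Instance), A.Promise φ x →
    ∃ ys : List B.Instance,
      (∀ y ∈ ys, B.Promise φ y) ∧
      RunsWithin φ Q (A.encode x) (Data.ofList (ys.map B.encode))
        (P.eval (A.encode x).size) ∧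
      ∀ as : List Data, List.Forall₂ (B.IsAnswer φ) ys as →
        ∃ z : Data, A.IsAnswer φ x z ∧
          RunsWithin φ E (.cons (A.encode x) (Data.ofList as)) z
            (P.eval (Data.cons (A.encode x) (Data.ofList as)).size)

/-- Polynomial-time equivalence (by nonadaptive reductions in both directions). -/
def PolyTimeEquivalent (A B : Problem) : Prop :=
  TruthTableReducible A B ∧ TruthTableReducible B A

/-! ### Hidden subgroups of permutation groups -/

/-- An input of the hidden subgroup problem over permutation groups: a degree `n`, a list of
generators of a group `G ≤ S_n`, a program for a function `f` on `G` (the program may call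
the black box, and may consist of one such call), and a time bound for it. -/
structure HSInstance where
  /-- the degree -/
  n : ℕ
  /-- the generators -/
  gens : List (Equiv.Perm (Fin n))
  /-- the program that computes the function -/
  prog : Prog
  /-- the time bound for this program -/
  time : ℕ

namespace HSInstance

/-- Numbers (the degree, the points and the time bound) are written in unary. -/
def encode (I : HSInstance) : Data :=
  .cons (.ofNat I.n) (.cons (.ofList (I.gens.map Data.ofPerm))
    (.cons I.prog.toData (.ofNat I.time)))

/-- The permutation group given by the generators. -/
def group (I : HSInstance) : Subgroup (Equiv.Perm (Fin I.n)) :=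
  Subgroup.closure {g | g ∈ I.gens}

/-- On all of `G`, the program halts within the time bound and computes `f`. -/
def Computes (φ : BlackBox) (I : HSInstance) (f : I.group → Data) : Prop :=
  ∀ g : I.group, RunsWithin φ I.prog (Data.ofPerm g.1) (f g) I.time

end HSInstance

/-- Which cosets are meant: `g H` or `H g`. -/
inductive Side where
  | left : Side
  | right : Side

/-- `g` and `k` lie in the same coset of `H` (on the given side). -/
def SameCoset {G : Type} [Group G] (s : Side) (H : Subgroup G) (g k : G) : Prop :=
  match s with
  | .left => g⁻¹ * k ∈ H
  | .right => k * g⁻¹ ∈ H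

/-- The function of the instance is constant on each coset of `H ≤ G`, and takes distinct values
on distinct cosets. -/
def Hides (s : Side) (φ : BlackBox) (I : HSInstance) (H : Subgroup I.group) : Prop :=
  ∃ f : I.group → Data, I.Computes φ f ∧ ∀ g k : I.group, f g = f k ↔ SameCoset s H g k

/-- The decision version: is the hidden subgroup nontrivial? -/
def HiddenSubgroupD (s : Side) : Problem where
  Instance := HSInstance
  encode := HSInstance.encode
  Promise φ I := ∃ H, Hides s φ I H
  IsAnswer φ I a := ∃ H, Hides s φ I H ∧ ((H ≠ ⊥ ∧ a = .yes) ∨ (H = ⊥ ∧ a = .nil))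

/-- The search version: find a nontrivial element of the hidden subgroup if there is one, and
report (by the answer `nil`) that there is none otherwise. -/
def HiddenSubgroupS (s : Side) : Problem where
  Instance := HSInstance
  encode := HSInstance.encode
  Promise φ I := ∃ H, Hides s φ I H
  IsAnswer φ I a := ∃ H, Hides s φ I H ∧
    ((∃ h ∈ H, h ≠ 1 ∧ a = .cons .nil (Data.ofPerm h.1)) ∨ (H = ⊥ ∧ a = .nil))

end HSP

namespace HSP

/-! ### Runs of programs -/

/-! Decision reduces to search by a single query. For the converse let `f` hide `H ≤ G ≤ S_n`, say
with left cosets.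

Gadget. For lists of points `p` and `q`, the wreath product `G ≀ C₂` acts on `n + n` points. To an
element with blocks `g`, `h` and no swap, assign `(f g, g p, f h, h q)`; with a swap, `p` and `q`
trade places. The swap bit itself is not part of the value. This function hides the subgroup of
those elements of `H ≀ C₂` that respect the pair `(p, q)`: without a swap `g p = p` and `h q = q`,
with a swap `g q = p` and `h p = q`. For `0 < n` it is nontrivial iff a nontrivial element of `H`
fixes `p` pointwise, or one fixes `q` pointwise, or some element of `H` maps `p` to `q`
(`exists_hides_query`, abbreviated by `Linked`).

Choice of lists. Let `K` be the pointwise stabilizer in `H` of the points less than `i`. A query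
`fixPair i j` tells whether a nontrivial element of `K` fixes `i` or `j`. If none does, the first
two alternatives also vanish for `mapsPair i j k l`, which then tells whether some element of `K`
maps `i` to `j` and `k` to `l`. At most one element of `K` maps `i` to `j`, so these answers spell
out its values. If `H ≠ ⊥`, suitable `i ≠ j` exist: take `i` last with `K` nontrivial and `j` in its
orbit under `K`; the stabilizers of `i` and `j` in `K` are conjugate, hence both trivial
(`exists_not_linked`). There are polynomially many quadruples, so all queries are asked at once, and
`evaluate_spec` reads off the result.

Right cosets become left cosets under inversion (`sameCoset_iff`). The remaining work shows that the
texts of the queries and the evaluation of the answers are computable in polynomial time. -/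

theorem Run.output_unique {φ : BlackBox} {p : Prog} {x y : Data} {t : ℕ} (h : Run φ p x y t) :
    ∀ {y' : Data} {t' : ℕ}, Run φ p x y' t' → y = y' := by
  induction h with
  | id | nil | hd | tl | eq | call => intro y' t' h'; cases h'; rfl
  | pair _ _ ih₁ ih₂ =>
    intro y' t' h'
    cases h' with
    | pair h₁ h₂ => rw [ih₁ h₁, ih₂ h₂]
  | comp _ _ ih₁ ih₂ =>
    intro y' t' h'
    cases h' with
    | comp h₁ h₂ =>
      obtain rfl := ih₁ h₁
      exact ih₂ h₂
  | iteTrue _ _ ih₁ ih₂ =>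
    intro y' t' h'
    cases h' with
    | iteTrue _ h₂ => exact ih₂ h₂
    | iteFalse h₁ _ => cases ih₁ h₁
  | iteFalse _ _ ih₁ ih₂ =>
    intro y' t' h'
    cases h' with
    | iteTrue h₁ _ => cases ih₁ h₁
    | iteFalse _ h₂ => exact ih₂ h₂
  | loopStop _ ih₁ =>
    intro y' t' h'
    cases h' with
    | loopStop _ => rfl
    | loopStep h₁ _ _ => cases ih₁ h₁
  | loopStep _ _ _ ih₁ ih₂ ih₃ =>
    intro y' t' h'
    cases h' with
    | loopStop h₁ => cases ih₁ h₁
    | loopStep _ h₂ h₃ =>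
      obtain rfl := ih₂ h₂
      exact ih₃ h₃

theorem Run.size_le {φ : BlackBox} {p : Prog} {x y : Data} {t : ℕ} (h : Run φ p x y t) :
    x.size ≤ t ∧ y.size ≤ t := by
  induction h <;> (try simp only [Data.size] at *) <;> omega

theorem RunsWithin.mono {φ : BlackBox} {p : Prog} {x y : Data} {S T : ℕ}
    (h : RunsWithin φ p x y S) (hST : S ≤ T) : RunsWithin φ p x y T := by
  obtain ⟨t, ht, h⟩ := h
  exact ⟨t, ht.trans hST, h⟩

theorem RunsWithin.output_unique {φ : BlackBox} {p : Prog} {x y y' : Data} {S T : ℕ}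
    (h : RunsWithin φ p x y S) (h' : RunsWithin φ p x y' T) : y = y' := by
  obtain ⟨_, _, h⟩ := h
  obtain ⟨_, _, h'⟩ := h'
  exact h.output_unique h'

theorem RunsWithin.size_le {φ : BlackBox} {p : Prog} {x y : Data} {T : ℕ}
    (h : RunsWithin φ p x y T) : y.size ≤ T := by
  obtain ⟨t, ht, h⟩ := h
  have := h.size_le
  omega

theorem RunsWithin.comp {φ : BlackBox} {p q : Prog} {x y z : Data} {S T : ℕ}
    (h₁ : RunsWithin φ p x y S) (h₂ : RunsWithin φ q y z T) :
    RunsWithin φ (.comp p q) x z (S + T + 1) := by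
  obtain ⟨s, hs, h₁⟩ := h₁
  obtain ⟨t, ht, h₂⟩ := h₂
  exact ⟨s + t + 1, by omega, h₁.comp h₂⟩

theorem RunsWithin.pair {φ : BlackBox} {p q : Prog} {x y z : Data} {S T : ℕ}
    (h₁ : RunsWithin φ p x y S) (h₂ : RunsWithin φ q x z T) :
    RunsWithin φ (.pair p q) x (.cons y z) (S + T + 1) := by
  obtain ⟨s, hs, h₁⟩ := h₁
  obtain ⟨t, ht, h₂⟩ := h₂
  exact ⟨s + t + 1, by omega, h₁.pair h₂⟩

/-! ### Sizes of trees, and trees as lists -/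

namespace Data

theorem size_pos (x : Data) : 0 < x.size := by cases x <;> simp [size]

theorem size_hd_le (x : Data) : x.hd.size ≤ x.size := by
  cases x <;> simp only [size, hd] <;> omega

theorem size_tl_le (x : Data) : x.tl.size ≤ x.size := by
  cases x <;> simp only [size, tl] <;> omega

theorem size_eqTest_le (x : Data) : x.eqTest.size ≤ 3 := by
  cases x with
  | nil => simp [eqTest, size]
  | cons a b => simp only [eqTest]; split <;> simp [yes, size]

/-- Every tree is a list of trees. -/
def toList : Data → List Data
  | nil => []
  | cons a b => a :: toList b

@[simp] theorem toList_nil : nil.toList = [] := rfl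

@[simp] theorem toList_cons (a b : Data) : (cons a b).toList = a :: b.toList := rfl

@[simp] theorem toList_tl (x : Data) : x.tl.toList = x.toList.tail := by cases x <;> rfl

@[simp] theorem hd_cons (a b : Data) : (cons a b).hd = a := rfl

@[simp] theorem tl_cons (a b : Data) : (cons a b).tl = b := rfl

@[simp] theorem toList_ofList (l : List Data) : (ofList l).toList = l := by
  induction l with
  | nil => rfl
  | cons a l ih => simp [ofList, ih]

@[simp] theorem ofList_toList (x : Data) : ofList x.toList = x := by
  induction x with
  | nil => rfl
  | cons a b _ ih => simp [ofList, toList, ih]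

theorem size_ofList (l : List Data) : (ofList l).size = (l.map fun a => a.size + 1).sum + 1 := by
  induction l with
  | nil => rfl
  | cons a l ih => simp only [ofList, size, ih, List.map_cons, List.sum_cons]; omega

theorem length_toList_le (x : Data) : x.toList.length ≤ x.size := by
  induction x with
  | nil => simp [toList]
  | cons a b _ ih => simp only [toList, List.length_cons, size]; omega

theorem size_le_of_mem_toList {a x : Data} (h : a ∈ x.toList) : a.size ≤ x.size := by
  induction x with
  | nil => simp [toList] at h
  | cons b c _ ih =>
    rcases List.mem_cons.1 h with rfl | h
    · simp only [size]; omega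
    · have := ih h
      simp only [size]; omega

theorem size_ofList_le {l : List Data} {B : ℕ} (h : ∀ a ∈ l, a.size ≤ B) :
    (ofList l).size ≤ l.length * (B + 1) + 1 := by
  induction l with
  | nil => simp [ofList, size]
  | cons a l ih =>
    have h₁ := h a (by simp)
    have h₂ := ih fun b hb => h b (by simp [hb])
    simp only [ofList, size, List.length_cons, add_mul, one_mul]
    omega

theorem size_ofList_append (l m : List Data) :
    (ofList (l ++ m)).size + 1 = (ofList l).size + (ofList m).size := by
  simp only [size_ofList, List.map_append, List.sum_append]
  omega

theorem ofNat_eq_ofList (k : ℕ) : ofNat k = ofList (List.replicate k nil) := by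
  induction k with
  | zero => rfl
  | succ k ih => simp [ofNat, ih, List.replicate_succ, ofList]

@[simp] theorem toList_ofNat (k : ℕ) : (ofNat k).toList = List.replicate k nil := by
  rw [ofNat_eq_ofList, toList_ofList]

theorem ofNat_injective : Function.Injective ofNat := fun a b h => by
  simpa using congrArg (fun x => x.toList.length) h

theorem ofList_injective : Function.Injective ofList := fun a b h => by
  simpa using congrArg toList h

@[simp] theorem size_ofNat (k : ℕ) : (ofNat k).size = 2 * k + 1 := by
  induction k with
  | zero => rfl
  | succ k ih => simp only [ofNat, size, ih]; omega

end Data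

/-! ### Polynomial-time functions -/

theorem eval_mono (P : Polynomial ℕ) {a b : ℕ} (h : a ≤ b) : P.eval a ≤ P.eval b := by
  rw [Polynomial.eval_eq_sum, Polynomial.eval_eq_sum]
  exact Finset.sum_le_sum fun i _ => Nat.mul_le_mul_left _ (Nat.pow_le_pow_left h i)

/-- Functions on trees which are computed by a program in polynomial time, whatever the black
box is. -/
@[fun_prop]
def PolyTime (f : Data → Data) : Prop :=
  ∃ (p : Prog) (P : Polynomial ℕ), ∀ φ x, RunsWithin φ p x (f x) (P.eval x.size)

namespace PolyTime

open Data Polynomial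

theorem size_le {f : Data → Data} (hf : PolyTime f) :
    ∃ P : Polynomial ℕ, ∀ x, (f x).size ≤ P.eval x.size := by
  obtain ⟨p, P, h⟩ := hf
  exact ⟨P, fun x => (h (fun x => x) x).size_le⟩

@[fun_prop] theorem id : PolyTime fun x => x :=
  ⟨.id, 2 * X + 1, fun φ x => ⟨_, by simp; omega, .id x⟩⟩

theorem hd' : PolyTime Data.hd :=
  ⟨.hd, 2 * X + 1, fun φ x => ⟨_, by have := x.size_hd_le; simp; omega, .hd x⟩⟩

theorem tl' : PolyTime Data.tl :=
  ⟨.tl, 2 * X + 1, fun φ x => ⟨_, by have := x.size_tl_le; simp; omega, .tl x⟩⟩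

theorem eqTest' : PolyTime Data.eqTest :=
  ⟨.eq, X + 4, fun φ x => ⟨_, by have := x.size_eqTest_le; simp; omega, .eq x⟩⟩

@[fun_prop] theorem comp {f g : Data → Data} (hf : PolyTime f) (hg : PolyTime g) :
    PolyTime fun x => f (g x) := by
  obtain ⟨B, hB⟩ := hg.size_le
  obtain ⟨p, P, hp⟩ := hf
  obtain ⟨q, Q, hq⟩ := hg
  refine ⟨.comp q p, Q + P.comp B + 1, fun φ x => ((hq φ x).comp (hp φ _)).mono ?_⟩
  have := eval_mono P (hB x)
  simp only [eval_add, eval_comp, eval_one]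
  omega

@[fun_prop] theorem hd {f : Data → Data} (hf : PolyTime f) : PolyTime fun x => (f x).hd :=
  hd'.comp hf

@[fun_prop] theorem tl {f : Data → Data} (hf : PolyTime f) : PolyTime fun x => (f x).tl :=
  tl'.comp hf

@[fun_prop] theorem cons {f g : Data → Data} (hf : PolyTime f) (hg : PolyTime g) :
    PolyTime fun x => .cons (f x) (g x) := by
  obtain ⟨p, P, hp⟩ := hf
  obtain ⟨q, Q, hq⟩ := hg
  refine ⟨.pair p q, P + Q + 1, fun φ x => ((hp φ x).pair (hq φ _)).mono ?_⟩
  simp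

@[fun_prop] theorem const (c : Data) : PolyTime fun _ => c := by
  induction c with
  | nil => exact ⟨.nil, X + 2, fun φ x => ⟨_, by simp [size], .nil x⟩⟩
  | cons a b iha ihb => exact iha.cons ihb

@[fun_prop] theorem ite {c f g : Data → Data} (hc : PolyTime c) (hf : PolyTime f)
    (hg : PolyTime g) : PolyTime fun x => if c x = .nil then f x else g x := by
  obtain ⟨r, R, hr⟩ := hc
  obtain ⟨p, P, hp⟩ := hf
  obtain ⟨q, Q, hq⟩ := hg
  refine ⟨.ite r q p, P + Q + R + 1, fun φ x => ?_⟩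
  simp only [eval_add, eval_one]
  obtain ⟨t₁, ht₁, h₁⟩ := hr φ x
  obtain ⟨t₂, ht₂, h₂⟩ := hp φ x
  obtain ⟨t₃, ht₃, h₃⟩ := hq φ x
  generalize hd : c x = d at h₁
  cases d with
  | nil => exact ⟨t₁ + t₂ + 1, by omega, by simpa using Run.iteFalse h₁ h₂⟩
  | cons a b => exact ⟨t₁ + t₃ + 1, by omega, by simpa using Run.iteTrue h₁ h₃⟩

@[fun_prop] theorem ite_eq {a b f g : Data → Data} (ha : PolyTime a) (hb : PolyTime b)
    (hf : PolyTime f) (hg : PolyTime g) : PolyTime fun x => if a x = b x then f x else g x := by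
  have := ite (eqTest'.comp (ha.cons hb)) hg hf
  convert this using 2 with x
  by_cases h : a x = b x <;> simp [eqTest, h, yes]

/-- A polynomial-time step may double the accumulator in every round, so a bound `B` on all
intermediate accumulators is required. The loop carries the input, the remaining list and the
accumulator. -/
theorem foldl {l i : Data → Data} {F : Data → Data → Data → Data} (hl : PolyTime l)
    (hi : PolyTime i) (hF : PolyTime fun e => F e.hd e.tl.hd e.tl.tl) (B : Polynomial ℕ)
    (hB : ∀ x k,
      ((((l x).toList.take k)).foldl (fun acc a => F x a acc) (i x)).size ≤ B.eval x.size) :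
    PolyTime fun x => (l x).toList.foldl (fun acc a => F x a acc) (i x) := by
  have hbody : PolyTime fun s => .cons s.hd (.cons s.tl.hd.tl
      (F s.hd s.tl.hd.hd s.tl.tl)) := by
    have hF' : PolyTime fun s => F s.hd s.tl.hd.hd s.tl.tl :=
      hF.comp (g := fun s => .cons s.hd (.cons s.tl.hd.hd s.tl.tl)) (by fun_prop)
    exact cons (by fun_prop) (cons (by fun_prop) hF')
  have hstart : PolyTime fun x => .cons x (.cons (l x) (i x)) := by fun_prop
  suffices h : PolyTime fun x =>
      .cons x (.cons .nil ((l x).toList.foldl (fun acc a => F x a acc) (i x))) from h.tl.tl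
  obtain ⟨L, hL⟩ := hl.size_le
  obtain ⟨p, P, hp⟩ := hbody
  obtain ⟨q, Q, hq⟩ := hstart
  -- `S` bounds the size of the loop state: its three parts and two pairing nodes. The term `10 * S`
  -- pays for the loop test in each round.
  let S : Polynomial ℕ := X + L + B + 2
  refine ⟨.comp q (.loop (.comp .tl .hd) p), Q + (L + 1) * (P.comp S + 10 * S) + 1,
    fun φ x => ?_⟩
  obtain ⟨m, hm⟩ : ∃ m, m = (l x).toList := ⟨_, rfl⟩
  have hlx : l x = ofList m := by rw [hm, ofList_toList]
  have hS : S.eval x.size = x.size + L.eval x.size + B.eval x.size + 2 := by simp [S]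
  have hLx := hL x
  have hlen := length_toList_le (l x)
  have key : ∀ (m' : List Data) (acc : Data), (ofList m').size ≤ L.eval x.size →
      (∀ k, ((m'.take k).foldl (fun acc a => F x a acc) acc).size ≤ B.eval x.size) →
      RunsWithin φ (.loop (.comp .tl .hd) p) (.cons x (.cons (ofList m') acc))
      (.cons x (.cons .nil (m'.foldl (fun acc a => F x a acc) acc)))
      ((m'.length + 1) * (P.eval (S.eval x.size) + 10 * S.eval x.size)) := by
    intro m'
    induction m' with
    | nil =>
      intro acc hsz hM
      have hM0 : acc.size ≤ B.eval x.size := by simpa using hM 0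
      refine ⟨_, ?_, .loopStop (.comp (.tl _) (.hd _))⟩
      simp only [ofList, size, Data.tl, Data.hd, List.length_nil] at hsz ⊢
      omega
    | cons a m' ih =>
      intro acc hsz hM
      have hM0 : acc.size ≤ B.eval x.size := by simpa using hM 0
      simp only [ofList, size] at hsz
      obtain ⟨t, ht, h₁⟩ := hp φ (.cons x (.cons (ofList (a :: m')) acc))
      obtain ⟨u, hu, h₂⟩ := ih (F x a acc) (by omega) fun k => by simpa using hM (k + 1)
      have ht' : t ≤ P.eval (S.eval x.size) := by
        refine ht.trans (eval_mono _ ?_)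
        simp only [ofList, size]
        omega
      refine ⟨_, ?_, .loopStep (.comp (.tl _) (.hd _)) h₁ h₂⟩
      simp only [ofList, size, Data.tl, Data.hd, List.length_cons]
      rw [add_mul (m'.length + 1)]
      omega
  have hrun := key m (i x) (hlx ▸ hLx) (by rw [hm]; exact hB x)
  rw [← hlx, hm] at hrun
  refine ((hq φ x).comp hrun).mono ?_
  simp only [eval_add, eval_mul, eval_comp, eval_one, eval_ofNat]
  gcongr
  omega

end PolyTime

/-! ### A library of polynomial-time functions -/

namespace Data

/-- Reversal of a list. -/
def reverse (d : Data) : Data := ofList d.toList.reverse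

/-- The list of the values of a function on the entries of a list. -/
def map (F : Data → Data) (d : Data) : Data := ofList (d.toList.map F)

/-- Concatenation of two lists. -/
def append (d e : Data) : Data := ofList (d.toList ++ e.toList)

/-- Concatenation of the lists `F a`, for the entries `a` of a list. -/
def bind (F : Data → Data) (d : Data) : Data := ofList (d.toList.flatMap fun a => (F a).toList)

/-- The list without its first entries; their number is the length of `k`. -/
def drop (k d : Data) : Data := ofList (d.toList.drop k.toList.length)

/-- The entry of a list whose index is the length of `k`. -/
def nth (k d : Data) : Data := (drop k d).hd

/-- The unary numbers that are less than the length of `d`. -/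
def range (d : Data) : Data := ofList ((List.range d.toList.length).map ofNat)

/-- The last value of a function on a list which is not `nil`. -/
def pick (F : Data → Data) (d : Data) : Data :=
  d.toList.foldl (fun acc a => if F a = nil then acc else F a) nil

/-- Here `nil` means failure. Only this dichotomy is used later; which of several hits is returned
plays no role. -/
theorem pick_spec (F : Data → Data) (d : Data) :
    (pick F d = nil ∧ ∀ a ∈ d.toList, F a = nil) ∨
      (pick F d ≠ nil ∧ ∃ a ∈ d.toList, pick F d = F a) := by
  unfold pick
  induction d.toList using List.reverseRecOn with
  | nil => simp
  | append_singleton l a ih =>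
    simp only [List.foldl_append, List.foldl_cons, List.foldl_nil, List.mem_append,
      List.mem_singleton]
    by_cases h : F a = nil
    · rw [if_pos h]
      rcases ih with ⟨h₁, h₂⟩ | ⟨h₁, b, hb, h₂⟩
      · refine Or.inl ⟨h₁, ?_⟩
        rintro b (hb | rfl)
        exacts [h₂ b hb, h]
      · exact Or.inr ⟨h₁, b, Or.inl hb, h₂⟩
    · rw [if_neg h]
      exact Or.inr ⟨h, a, Or.inr rfl, rfl⟩

end Data

namespace PolyTime

open Data Polynomial

@[fun_prop] theorem reverse {l : Data → Data} (hl : PolyTime l) :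
    PolyTime fun x => (l x).reverse := by
  obtain ⟨L, hL⟩ := hl.size_le
  have key : ∀ m : List Data, m.foldl (fun acc a => .cons a acc) .nil = ofList m.reverse := by
    intro m
    induction m using List.reverseRecOn with
    | nil => rfl
    | append_singleton m a ih => simp [ih, ofList]
  have := foldl (F := fun _ a acc => .cons a acc) hl (const .nil) (by fun_prop) L
    (fun x k => by
      refine le_trans ?_ (hL x)
      conv_rhs => rw [← ofList_toList (l x)]
      rw [key, size_ofList, size_ofList, List.map_reverse, List.sum_reverse]
      conv_rhs => rw [← List.take_append_drop k (l x).toList, List.map_append, List.sum_append]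
      omega)
  simp only [key] at this
  exact this

/-- Iteration from the right over a list. -/
theorem foldr {l i : Data → Data} {F : Data → Data → Data → Data} (hl : PolyTime l)
    (hi : PolyTime i) (hF : PolyTime fun e => F e.hd e.tl.hd e.tl.tl) (B : Polynomial ℕ)
    (hB : ∀ x m, m <:+ (l x).toList →
      (m.foldr (fun a acc => F x a acc) (i x)).size ≤ B.eval x.size) :
    PolyTime fun x => (l x).toList.foldr (fun a acc => F x a acc) (i x) := by
  have := foldl (F := F) hl.reverse hi hF B (fun x k => by
    rw [Data.reverse, toList_ofList, ← List.reverse_reverse ((l x).toList.reverse.take k),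
      List.foldl_reverse]
    refine hB x _ ?_
    rw [← List.reverse_reverse (l x).toList, List.reverse_suffix, List.reverse_reverse]
    exact List.take_prefix _ _)
  simpa [Data.reverse] using this

@[fun_prop] theorem append {f g : Data → Data} (hf : PolyTime f) (hg : PolyTime g) :
    PolyTime fun x => (f x).append (g x) := by
  obtain ⟨P, hP⟩ := hf.size_le
  obtain ⟨Q, hQ⟩ := hg.size_le
  have key : ∀ (m : List Data) (d : Data),
      m.foldr (fun a acc => .cons a acc) d = ofList (m ++ d.toList) := by
    intro m d
    induction m with
    | nil => simp
    | cons a m ih => simp [ih, ofList]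
  have := foldr (F := fun _ a acc => .cons a acc) hf hg (by fun_prop) (P + Q)
    (fun x m ⟨m', hm⟩ => by
      have h₁ := hP x
      have h₂ := hQ x
      have h₃ := size_ofList_append m' m
      have h₄ := size_ofList_append m (g x).toList
      rw [hm, ofList_toList] at h₃
      rw [ofList_toList] at h₄
      rw [key, eval_add]
      omega)
  simp only [key] at this
  exact this

theorem size_le_of_mem {l : Data → Data} {F : Data → Data → Data} (hl : PolyTime l)
    (hF : PolyTime fun e => F e.hd e.tl) :
    ∃ P : Polynomial ℕ, ∀ x, ∀ a ∈ (l x).toList, (F x a).size ≤ P.eval x.size := by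
  obtain ⟨L, hL⟩ := hl.size_le
  obtain ⟨P, hP⟩ := hF.size_le
  refine ⟨P.comp (X + L + 1), fun x a ha => (hP (.cons x a)).trans ?_⟩
  rw [eval_comp]
  refine eval_mono _ ?_
  have := (size_le_of_mem_toList ha).trans (hL x)
  simp only [size, eval_add, eval_X, eval_one]
  omega

@[fun_prop] theorem bind {l : Data → Data} {F : Data → Data → Data} (hl : PolyTime l)
    (hF : PolyTime fun e => F e.hd e.tl) : PolyTime fun x => Data.bind (F x) (l x) := by
  obtain ⟨L, hL⟩ := hl.size_le
  obtain ⟨P, hP⟩ := size_le_of_mem hl hF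
  have key : ∀ (F : Data → Data) (m : List Data),
      m.foldr (fun a acc => (F a).append acc) .nil
        = ofList (m.flatMap fun a => (F a).toList) := by
    intro F m
    induction m with
    | nil => rfl
    | cons a m ih =>
      simp only [List.foldr_cons, ih]
      simp [Data.append]
  have hF' : PolyTime fun e => F e.hd e.tl.hd :=
    hF.comp (g := fun e => .cons e.hd e.tl.hd) (by fun_prop)
  have := foldr (F := fun x a acc => (F x a).append acc) hl (const .nil)
    (hF'.append (by fun_prop)) (L * P + 1) (fun x m hm => by
      simp only [eval_add, eval_mul, eval_one]
      have h₁ : m.length ≤ L.eval x.size :=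
        (hm.length_le.trans (length_toList_le _)).trans (hL x)
      refine le_trans ?_ (Nat.add_le_add_right (Nat.mul_le_mul_right _ h₁) 1)
      have h₂ : ∀ a ∈ m, (F x a).size ≤ P.eval x.size := fun a ha => hP x a (hm.subset ha)
      clear hm h₁
      induction m with
      | nil => simp [size]
      | cons a m ih =>
        have h₃ := ih fun b hb => h₂ b (by simp [hb])
        have h₄ := h₂ a (by simp)
        have h₅ := size_ofList_append (F x a).toList
          (m.foldr (fun a acc => (F x a).append acc) .nil).toList
        simp only [ofList_toList] at h₅
        simp only [List.foldr_cons, List.length_cons, add_mul, one_mul]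
        rw [Data.append]
        omega)
  simp only [key] at this
  exact this

@[fun_prop] theorem map {l : Data → Data} {F : Data → Data → Data} (hl : PolyTime l)
    (hF : PolyTime fun e => F e.hd e.tl) : PolyTime fun x => Data.map (F x) (l x) := by
  have := bind (F := fun x a => .cons (F x a) .nil) hl (hF.cons (const .nil))
  simp only [Data.bind, toList_cons, toList_nil, ← List.map_eq_flatMap] at this
  exact this

@[fun_prop] theorem pick {l : Data → Data} {F : Data → Data → Data} (hl : PolyTime l)
    (hF : PolyTime fun e => F e.hd e.tl) : PolyTime fun x => Data.pick (F x) (l x) := by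
  obtain ⟨P, hP⟩ := size_le_of_mem hl hF
  have hF' : PolyTime fun e => F e.hd e.tl.hd :=
    hF.comp (g := fun e => .cons e.hd e.tl.hd) (by fun_prop)
  exact foldl (F := fun x a acc => if F x a = .nil then acc else F x a) hl (const .nil)
    (ite hF' (by fun_prop) hF') (P + 1) (fun x k => by
      rw [eval_add, eval_one]
      rcases pick_spec (F x) (ofList ((l x).toList.take k)) with ⟨h, -⟩ | ⟨-, a, ha, h⟩
      · rw [Data.pick, toList_ofList] at h
        rw [h]
        simp [size]
      · rw [Data.pick, toList_ofList] at h
        rw [toList_ofList] at ha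
        rw [h]
        exact (hP x a (List.mem_of_mem_take ha)).trans (by omega))

@[fun_prop] theorem drop {k l : Data → Data} (hk : PolyTime k) (hl : PolyTime l) :
    PolyTime fun x => Data.drop (k x) (l x) := by
  obtain ⟨L, hL⟩ := hl.size_le
  have key : ∀ (m : List Data) (d : Data),
      m.foldl (fun acc _ => acc.tl) d = ofList (d.toList.drop m.length) := by
    intro m
    induction m with
    | nil => simp
    | cons a m ih =>
      intro d
      rw [List.foldl_cons, ih]
      simp
  have := foldl (F := fun _ _ acc => acc.tl) hk hl (by fun_prop) L (fun x k => by
    refine le_trans ?_ (hL x)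
    generalize (List.take _ _) = m
    generalize l x = d
    induction m generalizing d with
    | nil => simp
    | cons a m ih => exact (ih d.tl).trans d.size_tl_le)
  simp only [key] at this
  exact this

@[fun_prop] theorem nth {k l : Data → Data} (hk : PolyTime k) (hl : PolyTime l) :
    PolyTime fun x => Data.nth (k x) (l x) := (hk.drop hl).hd

@[fun_prop] theorem range {l : Data → Data} (hl : PolyTime l) :
    PolyTime fun x => Data.range (l x) := by
  obtain ⟨L, hL⟩ := hl.size_le
  -- Prepending `0` to the successors of `0, …, k - 1` gives `0, …, k`, which makes the range a
  -- right fold.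
  have key : ∀ m : List Data,
      m.foldr (fun _ acc => .cons .nil (Data.map (fun a => .cons .nil a) acc)) .nil
        = ofList ((List.range m.length).map ofNat) := by
    intro m
    induction m with
    | nil => rfl
    | cons a m ih =>
      rw [List.length_cons, List.range_succ_eq_map, List.foldr_cons, ih]
      simp [Data.map, ofList, ofNat, Function.comp_def]
  have := foldr (F := fun _ _ acc => .cons .nil (Data.map (fun a => .cons .nil a) acc)) hl
    (const .nil) (cons (const .nil) (map (by fun_prop) (by fun_prop)))
    (L * (2 * L + 2) + 1) (fun x m hm => by
      have h₁ : m.length ≤ L.eval x.size :=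
        (hm.length_le.trans (length_toList_le _)).trans (hL x)
      rw [key]
      refine (size_ofList_le (B := 2 * m.length + 1) ?_).trans ?_
      · simp only [List.mem_map, List.mem_range]
        rintro _ ⟨a, ha, rfl⟩
        simp only [size_ofNat]
        omega
      · simp only [List.length_map, List.length_range, eval_add, eval_mul, eval_one, eval_ofNat]
        exact Nat.add_le_add_right (Nat.mul_le_mul h₁ (by omega)) 1)
  simp only [key] at this
  exact this

theorem ofNat_length {f : Data → Data} (hf : PolyTime f) :
    PolyTime fun x => ofNat (f x).toList.length := by
  have := map (F := fun _ _ => .nil) hf (const .nil)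
  simpa [Data.map, ofNat_eq_ofList] using this

/-- Polynomials in unary numbers. -/
theorem ofNat_eval {f : Data → Data} (hf : PolyTime f) (P : Polynomial ℕ) :
    PolyTime fun x => ofNat (P.eval (f x).toList.length) := by
  induction P using Polynomial.induction_on' with
  | add P Q hP hQ =>
    have := hP.append hQ
    simpa [Data.append, ofNat_eq_ofList] using this
  | monomial k c =>
    induction k with
    | zero => simpa using const _
    | succ k ih =>
      -- Replacing each entry of a list by a copy of the list `f x` multiplies the lengths, which
      -- supplies one more factor.
      have := bind (F := fun x _ => f x) ih (by exact hf.comp (by fun_prop))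
      convert this.ofNat_length using 3 with x
      simp [Data.bind, pow_succ, mul_assoc]

end PolyTime

/-! ### Permutations as data -/

namespace Data

/-- Lists of unary numbers. -/
def ofNats (l : List ℕ) : Data := ofList (l.map ofNat)

theorem ofNats_injective : Function.Injective ofNats :=
  ofList_injective.comp (List.map_injective_iff.2 ofNat_injective)

@[simp] theorem toList_ofNats (l : List ℕ) : (ofNats l).toList = l.map ofNat := toList_ofList _

theorem ofPerm_eq {n : ℕ} (g : Equiv.Perm (Fin n)) :
    ofPerm g = ofNats (List.ofFn fun i => (g i : ℕ)) := by
  simp [ofPerm, ofNats, List.map_ofFn, Function.comp_def]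

@[simp] theorem range_ofNat (n : ℕ) : range (ofNat n) = ofNats (List.range n) := by
  simp [range, ofNats]

theorem range_ofPerm {n : ℕ} (g : Equiv.Perm (Fin n)) :
    range (ofPerm g) = ofNats (List.range n) := by
  simp [range, ofNats, ofPerm_eq]

theorem map_ofNats {F : Data → Data} {f : ℕ → ℕ} {l : List ℕ}
    (h : ∀ k ∈ l, F (ofNat k) = ofNat (f k)) : map F (ofNats l) = ofNats (l.map f) := by
  simp only [map, toList_ofNats]
  rw [ofNats, List.map_map, List.map_map]
  congr 1
  exact List.map_congr_left h

theorem drop_ofNat (k m : ℕ) : drop (ofNat k) (ofNat m) = ofNat (m - k) := by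
  simp [drop, ofNat_eq_ofList]

theorem drop_ofNats (k : ℕ) (l : List ℕ) : drop (ofNat k) (ofNats l) = ofNats (l.drop k) := by
  simp [drop, ofNats]

theorem nth_ofList {k : ℕ} {l : List Data} (h : k < l.length) :
    nth (ofNat k) (ofList l) = l[k] := by
  simp only [nth, drop, toList_ofList, toList_ofNat, List.length_replicate]
  rw [List.drop_eq_getElem_cons h]
  rfl

theorem nth_ofNats {k : ℕ} {l : List ℕ} (h : k < l.length) :
    nth (ofNat k) (ofNats l) = ofNat l[k] := by
  rw [ofNats, nth_ofList (by simpa using h), List.getElem_map]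

theorem nth_ofPerm {n : ℕ} (g : Equiv.Perm (Fin n)) (i : Fin n) :
    nth (ofNat i) (ofPerm g) = ofNat (g i) := by
  rw [ofPerm_eq, nth_ofNats (by simp), List.getElem_ofFn]

/-- Lists of points. -/
def ofPoints {n : ℕ} (p : List (Fin n)) : Data := ofNats (p.map Fin.val)

theorem ofPoints_injective {n : ℕ} : Function.Injective (ofPoints (n := n)) :=
  ofNats_injective.comp (List.map_injective_iff.2 Fin.val_injective)

theorem ofPerm_eq_ofPoints {n : ℕ} (g : Equiv.Perm (Fin n)) :
    ofPerm g = ofPoints ((List.finRange n).map g) := by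
  rw [ofPerm_eq, ofPoints, List.ofFn_eq_map, List.map_map]
  rfl

theorem ofNats_range (n : ℕ) : ofNats (List.range n) = ofPoints (List.finRange n) := by
  simp [ofPoints]

theorem toList_ofPoints {n : ℕ} (p : List (Fin n)) :
    (ofPoints p).toList = p.map fun i : Fin n => ofNat i := by
  simp only [ofPoints, toList_ofNats, List.map_map, Function.comp_def]

theorem map_ofPoints {n m : ℕ} {F : Data → Data} {f : Fin n → Fin m} {l : List (Fin n)}
    (h : ∀ k ∈ l, F (ofNat k) = ofNat (f k)) : map F (ofPoints l) = ofPoints (l.map f) := by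
  simp only [map, toList_ofPoints]
  rw [ofPoints, ofNats, List.map_map, List.map_map, List.map_map]
  congr 1
  exact List.map_congr_left h

/-- The inverse of a permutation. -/
def inv (u : Data) : Data :=
  map (fun j => (pick (fun r => if nth r u = j then cons nil r else nil) (range u)).tl) (range u)

theorem inv_ofPerm {n : ℕ} (g : Equiv.Perm (Fin n)) : inv (ofPerm g) = ofPerm g⁻¹ := by
  rw [inv, range_ofPerm, ofNats_range, ofPerm_eq_ofPoints g⁻¹]
  refine map_ofPoints fun j _ => ?_
  -- A hit `r` is wrapped as `cons nil r`, because the point `0` is itself written as `nil`.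
  have h := pick_spec (fun r => if nth r (ofPerm g) = ofNat j then cons nil r else nil)
    (ofPoints (List.finRange n))
  simp only [toList_ofPoints, List.mem_map, List.mem_finRange, true_and, forall_exists_index,
    forall_apply_eq_imp_iff, nth_ofPerm, exists_exists_eq_and] at h
  rcases h with ⟨-, h⟩ | ⟨h₀, i, h⟩
  · have := h (g⁻¹ j)
    simp at this
  · rw [h] at h₀ ⊢
    split_ifs at h₀ ⊢ with hi
    · have : g i = j := Fin.ext (ofNat_injective hi)
      simp [← this]
    · exact absurd rfl h₀

/-- A permutation together with the images of a list of points. -/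
def withImages (p u : Data) : Data := cons u (map (fun r => nth r u) p)

theorem withImages_ofPerm {n : ℕ} (p : List (Fin n)) (g : Equiv.Perm (Fin n)) :
    withImages (ofPoints p) (ofPerm g) = cons (ofPerm g) (ofPoints (p.map g)) := by
  rw [withImages, map_ofPoints fun k _ => nth_ofPerm g k]

/-- Each entry is diminished by `n`. -/
def lower (n u : Data) : Data := map (fun a => drop n a) u

theorem lower_ofNats (n : ℕ) (l : List ℕ) :
    lower (ofNat n) (ofNats (l.map (n + ·))) = ofNats l := by
  rw [lower, map_ofNats (f := (· - n)) fun k _ => drop_ofNat n k]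
  simp [Function.comp_def]

/-- The two blocks of a permutation in the wreath product `S_n ≀ C₂`, each one with the images
of a list of points. -/
def blocks (n p q w : Data) : Data :=
  if drop n (cons nil w.hd) = nil then
    cons (withImages p (map (fun r => nth r w) (range n)))
      (withImages q (lower n (drop n w)))
  else
    cons (withImages q (drop n w))
      (withImages p (lower n (map (fun r => nth r w) (range n))))

/-- Inversion, for right cosets only. -/
def invOn : Side → Data → Data
  | .left => fun u => u
  | .right => inv

/-- What has to be computed before the function of the instance is called. -/
def prepare (s : Side) (e : Data) : Data :=
  let r := blocks e.hd.hd e.hd.tl.hd e.hd.tl.tl (invOn s e.tl)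
  cons (cons (invOn s r.hd.hd) r.hd.tl) (cons (invOn s r.tl.hd) r.tl.tl)

end Data

namespace PolyTime

open Data

@[fun_prop] theorem inv {u : Data → Data} (hu : PolyTime u) : PolyTime fun x => (u x).inv := by
  unfold Data.inv
  refine .map (by fun_prop) (.tl (.pick (by fun_prop) ?_))
  exact .ite_eq (by fun_prop) (by fun_prop) (by fun_prop) (by fun_prop)

@[fun_prop] theorem withImages {p u : Data → Data} (hp : PolyTime p) (hu : PolyTime u) :
    PolyTime fun x => Data.withImages (p x) (u x) := by
  unfold Data.withImages
  exact hu.cons (.map hp (by fun_prop))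

@[fun_prop] theorem lower {n u : Data → Data} (hn : PolyTime n) (hu : PolyTime u) :
    PolyTime fun x => Data.lower (n x) (u x) := by
  unfold Data.lower
  exact .map hu (by fun_prop)

@[fun_prop] theorem blocks {n p q w : Data → Data} (hn : PolyTime n) (hp : PolyTime p)
    (hq : PolyTime q) (hw : PolyTime w) :
    PolyTime fun x => Data.blocks (n x) (p x) (q x) (w x) := by
  unfold Data.blocks
  have hA : PolyTime fun x => Data.map (fun r => Data.nth r (w x)) (Data.range (n x)) :=
    .map (by fun_prop) (by fun_prop)
  exact .ite (by fun_prop) (by fun_prop) (by fun_prop)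

@[fun_prop] theorem invOn (s : Side) {u : Data → Data} (hu : PolyTime u) :
    PolyTime fun x => Data.invOn s (u x) := by
  cases s
  · exact hu
  · exact hu.inv

theorem prepare (s : Side) : PolyTime (Data.prepare s) := by
  unfold Data.prepare
  fun_prop

end PolyTime

/-! ### The wreath product -/

/-- The elements of the wreath product `S_n ≀ C₂`, acting on `n + n` points. -/
def wreath {n : ℕ} (g h : Equiv.Perm (Fin n)) (e : Bool) : Equiv.Perm (Fin (n + n)) :=
  finSumFinEquiv.permCongr
    (Equiv.Perm.sumCongr g h * if e then (Equiv.sumComm (Fin n) (Fin n) : Equiv.Perm _) else 1)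

section wreath

variable {n : ℕ} (g h g' h' : Equiv.Perm (Fin n)) (e : Bool)

theorem wreath_castAdd_false (i : Fin n) :
    wreath g h false (Fin.castAdd n i) = Fin.castAdd n (g i) := by
  simp [-Fin.natAdd_eq_addNat, wreath, Equiv.permCongr_apply]

theorem wreath_natAdd_false (i : Fin n) :
    wreath g h false (Fin.natAdd n i) = Fin.natAdd n (h i) := by
  simp [-Fin.natAdd_eq_addNat, wreath, Equiv.permCongr_apply]

theorem wreath_castAdd_true (i : Fin n) :
    wreath g h true (Fin.castAdd n i) = Fin.natAdd n (h i) := by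
  simp [-Fin.natAdd_eq_addNat, wreath, Equiv.permCongr_apply]

theorem wreath_natAdd_true (i : Fin n) :
    wreath g h true (Fin.natAdd n i) = Fin.castAdd n (g i) := by
  simp [-Fin.natAdd_eq_addNat, wreath, Equiv.permCongr_apply]

theorem wreath_one : wreath (1 : Equiv.Perm (Fin n)) 1 false = 1 := by
  ext i
  induction i using Fin.addCases <;> simp [-Fin.natAdd_eq_addNat, wreath_castAdd_false, wreath_natAdd_false]

theorem wreath_false_mul :
    wreath g h false * wreath g' h' e = wreath (g * g') (h * h') e := by
  ext i
  cases e <;> induction i using Fin.addCases <;>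
    simp [-Fin.natAdd_eq_addNat, wreath_castAdd_false, wreath_natAdd_false, wreath_castAdd_true, wreath_natAdd_true]

theorem wreath_true_mul :
    wreath g h true * wreath g' h' e = wreath (g * h') (h * g') (!e) := by
  ext i
  cases e <;> induction i using Fin.addCases <;>
    simp [-Fin.natAdd_eq_addNat, wreath_castAdd_false, wreath_natAdd_false, wreath_castAdd_true, wreath_natAdd_true]

theorem wreath_false_inv : (wreath g h false)⁻¹ = wreath g⁻¹ h⁻¹ false := by
  rw [inv_eq_iff_mul_eq_one, wreath_false_mul]
  simp [-Fin.natAdd_eq_addNat, wreath_one]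

theorem wreath_true_inv : (wreath g h true)⁻¹ = wreath h⁻¹ g⁻¹ true := by
  rw [inv_eq_iff_mul_eq_one, wreath_true_mul]
  simp [-Fin.natAdd_eq_addNat, wreath_one]

theorem ofPerm_wreath_false : Data.ofPerm (wreath g h false) = Data.ofNats
    ((List.ofFn fun i => (g i : ℕ)) ++ (List.ofFn fun i => (h i : ℕ)).map (n + ·)) := by
  rw [Data.ofPerm_eq, List.ofFn_add, List.map_ofFn]
  have h₁ : ∀ (hn : n ≤ n + n) i, wreath g h false (Fin.castLE hn i) = _ :=
    fun _ => wreath_castAdd_false g h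
  simp only [h₁, wreath_natAdd_false, Fin.val_castAdd, Fin.val_natAdd, Function.comp_def]

theorem ofPerm_wreath_true : Data.ofPerm (wreath g h true) = Data.ofNats
    ((List.ofFn fun i => (h i : ℕ)).map (n + ·) ++ (List.ofFn fun i => (g i : ℕ))) := by
  rw [Data.ofPerm_eq, List.ofFn_add, List.map_ofFn]
  have h₁ : ∀ (hn : n ≤ n + n) i, wreath g h true (Fin.castLE hn i) = _ :=
    fun _ => wreath_castAdd_true g h
  simp only [h₁, wreath_natAdd_true, Fin.val_castAdd, Fin.val_natAdd, Function.comp_def]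

theorem map_nth_range (l m : List ℕ) (hl : l.length = n) :
    Data.map (fun r => Data.nth r (Data.ofNats (l ++ m))) (Data.range (Data.ofNat n))
      = Data.ofNats l := by
  subst hl
  rw [Data.range_ofNat, Data.map_ofNats (f := fun k => (l ++ m).getD k 0)]
  · congr 1
    refine List.ext_getElem (by simp) fun k h₁ h₂ => ?_
    have h₃ : k < (l ++ m).length := by rw [List.length_append]; omega
    rw [List.getElem_map, List.getElem_range, List.getD_eq_getElem _ _ h₃,
      List.getElem_append_left h₂]
  · intro k hk
    have hk : k < (l ++ m).length := by
      have := List.mem_range.1 hk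
      rw [List.length_append]
      omega
    rw [Data.nth_ofNats hk, List.getD_eq_getElem _ _ hk]

theorem drop_append (l m : List ℕ) (hl : l.length = n) :
    Data.drop (Data.ofNat n) (Data.ofNats (l ++ m)) = Data.ofNats m := by
  rw [Data.drop_ofNats, ← hl, List.drop_left]

/-- The swap bit is recovered from the image of the point `0`, which lies in the first block exactly
if there is no swap. -/
theorem blocks_wreath (p q : List (Fin n)) :
    Data.blocks (.ofNat n) (.ofPoints p) (.ofPoints q) (Data.ofPerm (wreath g h e)) =
      .cons (.cons (.ofPerm g) (.ofPoints ((if e then q else p).map g)))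
        (.cons (.ofPerm h) (.ofPoints ((if e then p else q).map h))) := by
  have hd_eq : ∀ (k : ℕ) (l m : List ℕ), (Data.ofNats (k :: l ++ m)).hd = .ofNat k :=
    fun _ _ _ => rfl
  -- The extra `cons nil` turns `k` into `k + 1`, so the truncated difference `k + 1 - n` vanishes
  -- exactly for `k < n`.
  have drop_eq : ∀ k : ℕ,
      Data.drop (.ofNat n) (.cons .nil (.ofNat k)) = .nil ↔ k < n := fun k => by
    change Data.drop (.ofNat n) (.ofNat (k + 1)) = .ofNat 0 ↔ k < n
    rw [Data.drop_ofNat, Data.ofNat_injective.eq_iff]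
    omega
  unfold Data.blocks
  -- In degree `0` there is no point whose image could be inspected, but then all lists are empty
  -- and either bit gives the same result.
  rcases Nat.eq_zero_or_pos n with rfl | hn
  · obtain rfl : p = [] := List.eq_nil_of_subset_nil fun i _ => i.elim0
    obtain rfl : q = [] := List.eq_nil_of_subset_nil fun i _ => i.elim0
    cases e <;> rfl
  obtain ⟨m, rfl⟩ := Nat.exists_eq_add_of_lt hn
  cases e
  · rw [ofPerm_wreath_false, map_nth_range _ _ (by simp), drop_append _ _ (by simp),
      Data.lower_ofNats, ← Data.ofPerm_eq, ← Data.ofPerm_eq, Data.withImages_ofPerm,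
      Data.withImages_ofPerm, if_pos]
    · rfl
    · rw [List.ofFn_succ, hd_eq, drop_eq]
      exact Fin.is_lt _
  · rw [ofPerm_wreath_true, map_nth_range _ _ (by simp), drop_append _ _ (by simp),
      Data.lower_ofNats, ← Data.ofPerm_eq, ← Data.ofPerm_eq, Data.withImages_ofPerm,
      Data.withImages_ofPerm, if_neg]
    · rfl
    · rw [List.ofFn_succ, List.map_cons, hd_eq, drop_eq]
      omega

end wreath


/-! ### The queries -/

/-- The program with constant value `d`. -/
def constProg : Data → Prog
  | .nil => .nil
  | .cons a b => .pair (constProg a) (constProg b)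

theorem runsWithin_constProg (φ : BlackBox) (d x : Data) :
    RunsWithin φ (constProg d) x d (d.size * (x.size + 2)) := by
  induction d with
  | nil => exact ⟨_, by simp [Data.size], .nil x⟩
  | cons a b iha ihb =>
    refine (iha.pair ihb).mono ?_
    simp only [Data.size, add_mul]
    omega

/-- Apply the program `p` to the first components of both components of the input. -/
def callTwice (p : Prog) : Prog :=
  .pair (.comp .hd (.pair (.comp .hd p) .tl)) (.comp .tl (.pair (.comp .hd p) .tl))

theorem runsWithin_callTwice {φ : BlackBox} {p : Prog} {u v a b y z : Data} {T : ℕ}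
    (hu : RunsWithin φ p u y T) (hv : RunsWithin φ p v z T) :
    RunsWithin φ (callTwice p) (.cons (.cons u a) (.cons v b)) (.cons (.cons y a) (.cons z b))
      (10 * (Data.cons (.cons u a) (.cons v b)).size + (T + T)) := by
  obtain ⟨s, hs, hu⟩ := hu
  obtain ⟨t, ht, hv⟩ := hv
  refine ⟨_, ?_, .pair (.comp (.hd _) (.pair (.comp (.hd _) hu) (.tl _)))
    (.comp (.tl _) (.pair (.comp (.hd _) hv) (.tl _)))⟩
  simp only [Data.size, Data.hd, Data.tl]
  have := u.size_pos
  have := v.size_pos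
  omega

/-- The program of a query. -/
def queryProg (pre : Prog) (d : Data) (p : Prog) : Prog :=
  .comp (.comp (.pair (constProg d) .id) pre) (callTwice p)

/-- `pre` is a program for `Data.prepare s`, and the polynomial `R` of `n` bounds the time that is
needed for a query in addition to the two calls of the given function. -/
def Prepares (s : Side) (pre : Prog) (R : Polynomial ℕ) : Prop :=
  ∀ (φ : BlackBox) (p : Prog) (n : ℕ) (d w u v a b y z : Data) (T : ℕ),
    d.size + w.size ≤ 20 * (n + 1) ^ 2 →
    Data.prepare s (.cons d w) = .cons (.cons u a) (.cons v b) →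
    RunsWithin φ p u y T → RunsWithin φ p v z T →
    RunsWithin φ (queryProg pre d p) w (.cons (.cons y a) (.cons z b)) (R.eval n + (T + T))

-- The time bound of a query is written into the query, so it must be computable from the instance:
-- the overhead is a fixed polynomial in `n`, and each call of the given program is covered by its
-- own stated bound `T`.
open Polynomial in
theorem exists_prepares (s : Side) : ∃ pre R, Prepares s pre R := by
  obtain ⟨pre, P, h⟩ := PolyTime.prepare s
  let S : Polynomial ℕ := 20 * (X + 1) ^ 2
  refine ⟨pre, S * (S + 2) + 2 * S + 1 + 1 + P.comp (S + 1) + 1 + 10 * P.comp (S + 1) + 1,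
    fun φ p n d w u v a b y z T hn he hu hv => ?_⟩
  have hS : S.eval n = 20 * (n + 1) ^ 2 := by simp [S]
  rw [← hS] at hn
  have h₁ := h φ (.cons d w)
  rw [he] at h₁
  have h₂ := h₁.size_le
  refine (((runsWithin_constProg φ d w).pair ⟨_, le_rfl, .id w⟩).comp h₁ |>.comp
    (runsWithin_callTwice hu hv)).mono ?_
  have h₃ : P.eval (Data.cons d w).size ≤ P.eval (S.eval n + 1) := by
    refine eval_mono P ?_
    simp only [Data.size]
    omega
  have h₄ : d.size * (w.size + 2) ≤ S.eval n * (S.eval n + 2) :=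
    Nat.mul_le_mul (by omega) (by omega)
  simp only [eval_add, eval_mul, eval_comp, eval_one, eval_ofNat]
  omega

/-- The instance for a query about the lists of points `p` and `q`. Its group is the wreath
product `G ≀ C₂`, and it hides the stabilizer of a pair of points. -/
def query (pre : Prog) (R : Polynomial ℕ) (I : HSInstance) (p q : List (Fin I.n)) :
    HSInstance where
  n := I.n + I.n
  gens := wreath 1 1 true :: I.gens.map fun g => wreath g 1 false
  prog := queryProg pre (.cons (.ofNat I.n) (.cons (.ofPoints p) (.ofPoints q))) I.prog
  time := R.eval I.n + (I.time + I.time)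

/-- Conjugation by the swap moves a generator from the first block to the second, so one copy of the
generators and the swap suffice. -/
theorem mem_group_query {pre : Prog} {R : Polynomial ℕ} {I : HSInstance}
    {p q : List (Fin I.n)} {w : Equiv.Perm (Fin (I.n + I.n))} :
    w ∈ (query pre R I p q).group ↔
      ∃ (g h : I.group) (e : Bool), w = wreath g.1 h.1 e := by
  constructor
  · intro hw
    change w ∈ Subgroup.closure _ at hw
    induction hw using Subgroup.closure_induction with
    | mem w hw =>
      rcases List.mem_cons.1 hw with rfl | hw
      · exact ⟨1, 1, true, rfl⟩
      · obtain ⟨g, hg, rfl⟩ := List.mem_map.1 hw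
        exact ⟨⟨g, Subgroup.subset_closure hg⟩, 1, false, rfl⟩
    | one => exact ⟨1, 1, false, wreath_one.symm⟩
    | mul v w _ _ hv hw =>
      obtain ⟨g, h, e, rfl⟩ := hv
      obtain ⟨g', h', e', rfl⟩ := hw
      cases e
      · exact ⟨g * g', h * h', e', wreath_false_mul _ _ _ _ _⟩
      · exact ⟨g * h', h * g', !e', wreath_true_mul _ _ _ _ _⟩
    | inv w _ hw =>
      obtain ⟨g, h, e, rfl⟩ := hw
      cases e
      · exact ⟨g⁻¹, h⁻¹, false, wreath_false_inv _ _⟩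
      · exact ⟨h⁻¹, g⁻¹, true, wreath_true_inv _ _⟩
  · rintro ⟨⟨g, hg⟩, ⟨h, hh⟩, e, rfl⟩
    set S : Subgroup (Equiv.Perm (Fin (I.n + I.n))) :=
      Subgroup.closure {w | w ∈ (query pre R I p q).gens}
    change wreath g h e ∈ S
    have hτ : wreath 1 1 true ∈ S := Subgroup.subset_closure (List.mem_cons_self)
    have hleft : ∀ g ∈ I.group, wreath g 1 false ∈ S := by
      intro g hg
      change g ∈ Subgroup.closure _ at hg
      induction hg using Subgroup.closure_induction with
      | mem g hg =>
        exact Subgroup.subset_closure (List.mem_cons_of_mem _ (List.mem_map_of_mem hg))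
      | one => rw [wreath_one]; exact S.one_mem
      | mul g h _ _ hg hh => simpa [wreath_false_mul] using S.mul_mem hg hh
      | inv g _ hg => simpa [wreath_false_inv] using S.inv_mem hg
    have hright : wreath 1 h false ∈ S := by
      simpa [wreath_true_mul, wreath_false_mul] using
        S.mul_mem (S.mul_mem hτ (hleft h hh)) hτ
    have hboth : wreath g h false ∈ S := by
      simpa [wreath_false_mul] using S.mul_mem (hleft g hg) hright
    cases e
    · exact hboth
    · simpa [wreath_false_mul] using S.mul_mem hboth hτ

/-! ### Hidden subgroups -/

/-- Inversion, for right cosets only. -/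
def Side.invOn {G : Type} [Group G] : Side → G → G
  | .left => fun g => g
  | .right => fun g => g⁻¹

section invOn

variable {G : Type} [Group G] (s : Side)

@[simp] theorem invOn_invOn (g : G) : s.invOn (s.invOn g) = g := by
  cases s <;> simp [Side.invOn]

@[simp] theorem invOn_one : s.invOn (1 : G) = 1 := by
  cases s <;> simp [Side.invOn]

/-- Inversion exchanges right cosets with left cosets, so both conventions can be treated as one. -/
theorem sameCoset_iff (H : Subgroup G) (g k : G) :
    SameCoset s H g k ↔ (s.invOn g)⁻¹ * s.invOn k ∈ H := by
  cases s
  · rfl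
  · rw [← inv_mem_iff]
    simp [SameCoset, Side.invOn]

theorem coe_invOn (H : Subgroup G) (g : H) : ((s.invOn g : H) : G) = s.invOn (g : G) := by
  cases s <;> rfl

theorem invOn_ofPerm {n : ℕ} (g : Equiv.Perm (Fin n)) :
    Data.invOn s (.ofPerm g) = .ofPerm (s.invOn g) := by
  cases s
  · rfl
  · exact Data.inv_ofPerm g

end invOn

theorem HSInstance.Computes.unique {φ : BlackBox} {I : HSInstance} {f f' : I.group → Data}
    (h : I.Computes φ f) (h' : I.Computes φ f') : f = f' :=
  funext fun g => (h g).output_unique (h' g)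

/-- Runs are deterministic, so the function is determined by the program, and the subgroup is the
coset of `1`. An answer only asserts that it is right for some hidden subgroup; uniqueness makes it
an answer about the intended one. -/
theorem Hides.unique {s : Side} {φ : BlackBox} {I : HSInstance} {H H' : Subgroup I.group}
    (h : Hides s φ I H) (h' : Hides s φ I H') : H = H' := by
  obtain ⟨f, hf, h⟩ := h
  obtain ⟨f', hf', h'⟩ := h'
  obtain rfl := hf.unique hf'
  ext g
  have := (h 1 (s.invOn g)).symm.trans (h' 1 (s.invOn g))
  simpa [sameCoset_iff] using this

theorem size_ofPoints_le {n : ℕ} (p : List (Fin n)) :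
    (Data.ofPoints p).size ≤ p.length * (2 * n + 1) + 1 := by
  refine (Data.size_ofList_le (B := 2 * n) ?_).trans (by simp)
  simp only [List.map_map, List.mem_map, Function.comp_apply]
  rintro _ ⟨i, _, rfl⟩
  rw [Data.size_ofNat]
  omega

/-! ### The subgroup hidden by a query -/

section query

variable {s : Side} {pre : Prog} {R : Polynomial ℕ} {φ : BlackBox} {I : HSInstance}
  {p q : List (Fin I.n)} {f : I.group → Data}

/-- The value of the function of a query at the element of the wreath product with blocks `g`
and `h`. -/
def queryValue (s : Side) (f : I.group → Data) (p q : List (Fin I.n)) (g h : I.group) (e : Bool) :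
    Data :=
  .cons (.cons (f (s.invOn g)) (.ofPoints ((if e then q else p).map g.1)))
    (.cons (f (s.invOn h)) (.ofPoints ((if e then p else q).map h.1)))

theorem runsWithin_query (hpre : Prepares s pre R) (hf : I.Computes φ f)
    (hp : p.length ≤ I.n + 2) (hq : q.length ≤ I.n + 2) (g h : I.group) (e : Bool) :
    RunsWithin φ (query pre R I p q).prog (.ofPerm (s.invOn (wreath g.1 h.1 e)))
      (queryValue s f p q g h e) (query pre R I p q).time := by
  refine hpre φ _ I.n _ _ (.ofPerm (s.invOn g).1) (.ofPerm (s.invOn h).1) _ _ _ _ _ ?_ ?_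
    (hf _) (hf _)
  -- The three estimates add up to at most `12 n² + 14 n + 10`.
  · have h₁ := size_ofPoints_le p
    have h₂ := size_ofPoints_le q
    have h₃ := size_ofPoints_le ((List.finRange (I.n + I.n)).map
      (s.invOn (wreath g.1 h.1 e) : Equiv.Perm (Fin (I.n + I.n))))
    rw [← Data.ofPerm_eq_ofPoints, List.length_map, List.length_finRange] at h₃
    simp only [Data.size, Data.size_ofNat]
    nlinarith
  · simp only [Data.prepare, Data.hd_cons, Data.tl_cons, invOn_ofPerm, invOn_invOn,
      blocks_wreath, coe_invOn]

/-- Equality of values is invariant under left multiplication, so the level set of `1` is a subgroup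
and the level sets are its left cosets. Positivity of the degree is needed because the swap is the
identity on the empty set. -/
theorem exists_hides_query {H : Subgroup I.group} (hpre : Prepares s pre R)
    (hH : Hides s φ I H) (hp : p.length ≤ I.n + 2) (hq : q.length ≤ I.n + 2) :
    ∃ H', Hides s φ (query pre R I p q) H' ∧ (0 < I.n → (H' ≠ ⊥ ↔
      (∃ h ∈ H, h ≠ 1 ∧ p.map h.1 = p) ∨ (∃ h ∈ H, h ≠ 1 ∧ q.map h.1 = q) ∨
        ∃ h ∈ H, p.map h.1 = q)) := by
  obtain ⟨f, hf, hH⟩ := hH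
  have hfH : ∀ g k, f (s.invOn g) = f (s.invOn k) ↔ g⁻¹ * k ∈ H := fun g k => by
    simp [hH, sameCoset_iff]
  have hrun : ∀ w : (query pre R I p q).group, ∃ y,
      RunsWithin φ (query pre R I p q).prog (.ofPerm w.1) y (query pre R I p q).time := by
    intro w
    obtain ⟨g, h, e, hw⟩ := mem_group_query.1 (s.invOn w).2
    have := runsWithin_query hpre hf hp hq g h e
    rw [← hw, coe_invOn] at this
    exact ⟨_, Eq.subst (motive := fun u => RunsWithin φ _ (Data.ofPerm u) _ _)
      (invOn_invOn s w.1) this⟩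
  choose f₀ hf₀ using hrun
  -- Precomposing with `s.invOn` leaves only left cosets to consider.
  obtain ⟨F, hF⟩ : ∃ F : (query pre R I p q).group → Data, ∀ w, F w = f₀ (s.invOn w) :=
    ⟨_, fun _ => rfl⟩
  have hval : ∀ w (g h : I.group) e, w.1 = wreath g.1 h.1 e →
      F w = queryValue s f p q g h e := by
    intro w g h e hw
    rw [hF]
    refine (hf₀ _).output_unique (T := (query pre R I p q).time) ?_
    rw [coe_invOn]
    exact hw ▸ runsWithin_query hpre hf hp hq g h e
  have hmul : ∀ v w w', F w = F w' → F (v * w) = F (v * w') := by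
    intro v w w' h
    obtain ⟨g, k, e, hw⟩ := mem_group_query.1 w.2
    obtain ⟨g', k', e', hw'⟩ := mem_group_query.1 w'.2
    obtain ⟨a, b, c, hv⟩ := mem_group_query.1 v.2
    rw [hval w g k e hw, hval w' g' k' e' hw'] at h
    simp only [queryValue, Data.cons.injEq, hfH, Data.ofPoints_injective.eq_iff] at h
    obtain ⟨⟨h₁, h₂⟩, h₃, h₄⟩ := h
    cases c
    · rw [hval (v * w) (a * g) (b * k) e
          ((congrArg₂ (· * ·) hv hw).trans (wreath_false_mul _ _ _ _ _)),
        hval (v * w') (a * g') (b * k') e'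
          ((congrArg₂ (· * ·) hv hw').trans (wreath_false_mul _ _ _ _ _))]
      simp only [queryValue, Data.cons.injEq, hfH,
        Subgroup.coe_mul, Equiv.Perm.coe_mul, ← List.map_map, h₂, h₄, and_true]
      constructor
      · simpa [mul_assoc] using h₁
      · simpa [mul_assoc] using h₃
    -- A swap in `v` exchanges the blocks and flips the bit, so each block keeps its own list of
    -- points and the two coset conditions trade places.
    · rw [hval (v * w) (a * k) (b * g) (!e)
          ((congrArg₂ (· * ·) hv hw).trans (wreath_true_mul _ _ _ _ _)),
        hval (v * w') (a * k') (b * g') (!e')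
          ((congrArg₂ (· * ·) hv hw').trans (wreath_true_mul _ _ _ _ _))]
      have hnot : ∀ (e : Bool) (p q : List (Fin I.n)),
          (if !e then q else p) = if e then p else q := fun e p q => by cases e <;> rfl
      simp only [queryValue, Data.cons.injEq, hfH,
        Subgroup.coe_mul, Equiv.Perm.coe_mul, ← List.map_map, hnot, h₂, h₄, and_true]
      constructor
      · simpa [mul_assoc] using h₃
      · simpa [mul_assoc] using h₁
  let H' : Subgroup (query pre R I p q).group :=
    { carrier := {w | F w = F 1}
      one_mem' := rfl
      mul_mem' := fun {a b} ha hb => by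
        have := hmul a b 1 hb
        rw [mul_one] at this
        exact this.trans ha
      inv_mem' := fun {a} ha => by
        have := hmul a⁻¹ a 1 ha
        rw [inv_mul_cancel, mul_one] at this
        exact this.symm }
  refine ⟨H', ⟨f₀, hf₀, fun g k => ?_⟩, fun hn => ?_⟩
  · rw [sameCoset_iff]
    change f₀ g = f₀ k ↔ F ((s.invOn g)⁻¹ * s.invOn k) = F 1
    have h₁ : f₀ g = F (s.invOn g) := by rw [hF, invOn_invOn]
    have h₂ : f₀ k = F (s.invOn k) := by rw [hF, invOn_invOn]
    rw [h₁, h₂]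
    constructor
    · intro h
      have := hmul (s.invOn g)⁻¹ _ _ h
      rw [inv_mul_cancel] at this
      exact this.symm
    · intro h
      have := hmul (s.invOn g) _ _ h
      rw [mul_inv_cancel_left, mul_one] at this
      exact this.symm
  have hmem : ∀ w (g h : I.group) e, w.1 = wreath g.1 h.1 e → (w ∈ H' ↔
      (g ∈ H ∧ (if e then q else p).map g.1 = p) ∧
        (h ∈ H ∧ (if e then p else q).map h.1 = q)) := by
    intro w g h e hw
    change F w = F 1 ↔ _
    rw [hval w g h e hw, hval 1 1 1 false wreath_one.symm]
    simp only [queryValue, Data.cons.injEq, hfH, Data.ofPoints_injective.eq_iff]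
    simp
  rw [Subgroup.ne_bot_iff_exists_ne_one]
  constructor
  · rintro ⟨⟨w, hwH⟩, hw1⟩
    obtain ⟨g, h, e, hw⟩ := mem_group_query.1 w.2
    obtain ⟨⟨hg, hgp⟩, hh, hhq⟩ := (hmem w g h e hw).1 hwH
    cases e
    · by_cases hg1 : g = 1
      · by_cases hh1 : h = 1
        · subst hg1 hh1
          refine absurd ?_ hw1
          ext1
          ext1
          exact hw.trans wreath_one
        · exact Or.inr (Or.inl ⟨h, hh, hh1, hhq⟩)
      · exact Or.inl ⟨g, hg, hg1, hgp⟩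
    · exact Or.inr (Or.inr ⟨h, hh, hhq⟩)
  · have key : ∀ (g h : I.group) e, wreath g.1 h.1 e ≠ 1 →
        ((g ∈ H ∧ (if e then q else p).map g.1 = p) ∧
        (h ∈ H ∧ (if e then p else q).map h.1 = q)) → ∃ a : H', a ≠ 1 := by
      intro g h e h₁ h₂
      refine ⟨⟨⟨wreath g.1 h.1 e, mem_group_query.2 ⟨g, h, e, rfl⟩⟩,
        (hmem _ g h e rfl).2 h₂⟩, fun h₃ => h₁ ?_⟩
      exact congrArg (fun a : H' => a.1.1) h₃
    have hne : ∀ (g : I.group), g ≠ 1 → ∃ i, g.1 i ≠ i := by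
      intro g hg
      by_contra! h
      exact hg (Subtype.ext (Equiv.ext h))
    rintro (⟨h, hh, h1, hfix⟩ | ⟨h, hh, h1, hfix⟩ | ⟨h, hh, hpq⟩)
    · refine key h 1 false (fun h₂ => ?_) ⟨⟨hh, hfix⟩, H.one_mem, by simp⟩
      obtain ⟨i, hi⟩ := hne h h1
      have := DFunLike.congr_fun h₂ (Fin.castAdd I.n i)
      rw [wreath_castAdd_false] at this
      exact hi (Fin.castAdd_injective _ _ this)
    · refine key 1 h false (fun h₂ => ?_) ⟨⟨H.one_mem, by simp⟩, hh, hfix⟩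
      obtain ⟨i, hi⟩ := hne h h1
      have := DFunLike.congr_fun h₂ (Fin.natAdd I.n i)
      rw [wreath_natAdd_false] at this
      exact hi (Fin.natAdd_injective _ _ this)
    -- If `h` maps `p` to `q`, then `h⁻¹` maps `q` back to `p`. The element is nontrivial even for
    -- `h = 1`, since it moves the point `0` to the other block.
    · refine key h⁻¹ h true (fun h₂ => ?_) ⟨⟨H.inv_mem hh, ?_⟩, hh, hpq⟩
      · have := DFunLike.congr_fun h₂ (Fin.castAdd I.n ⟨0, hn⟩)
        rw [wreath_castAdd_true] at this
        have := congrArg Fin.val this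
        simp only [Fin.val_natAdd, Equiv.Perm.one_apply, Fin.val_castAdd] at this
        omega
      · simp [← hpq, Function.comp_def]

end query

/-! ### Computing the queries -/

namespace Data

/-- The text of `Prog.pair`. -/
def pairText (x y : Data) : Data := cons (ofNat 6) (cons x y)

/-- The text of `Prog.comp`. -/
def compText (x y : Data) : Data := cons (ofNat 7) (cons x y)

/-- The text of a program for a constant list. -/
def listText (F : Data → Data) (d : Data) : Data :=
  d.toList.foldr (fun a acc => pairText (F a) acc) Prog.nil.toData

/-- The text of a program for a constant number. -/
def numText (d : Data) : Data := listText (fun _ => Prog.nil.toData) d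

/-- The text of a program for a constant list of numbers. -/
def numsText (d : Data) : Data := listText numText d

/-- `constProg` recurses into both components, whereas a fold only follows the tail. The constants
in a query are numbers and lists of numbers, so nested folds suffice to write its text. -/
theorem listText_ofList {F : Data → Data} {l : List Data}
    (h : ∀ a ∈ l, F a = (constProg a).toData) :
    listText F (ofList l) = (constProg (ofList l)).toData := by
  rw [listText, toList_ofList]
  induction l with
  | nil => rfl
  | cons a l ih =>
    rw [List.foldr_cons, ih fun b hb => h b (by simp [hb]), h a (by simp)]
    rfl

theorem numText_ofNat (k : ℕ) : numText (ofNat k) = (constProg (ofNat k)).toData := by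
  rw [ofNat_eq_ofList]
  refine listText_ofList fun a ha => ?_
  rw [List.eq_of_mem_replicate ha]
  rfl

theorem numsText_ofNats (l : List ℕ) : numsText (ofNats l) = (constProg (ofNats l)).toData := by
  refine listText_ofList fun a ha => ?_
  obtain ⟨k, _, rfl⟩ := List.mem_map.1 ha
  exact numText_ofNat k

/-- The text of `callTwice`. -/
def callTwiceText (p : Data) : Data :=
  pairText
    (compText Prog.hd.toData (pairText (compText Prog.hd.toData p) Prog.tl.toData))
    (compText Prog.tl.toData (pairText (compText Prog.hd.toData p) Prog.tl.toData))

/-- The text of the program of a query. -/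
def queryText (pre : Prog) (n p q t : Data) : Data :=
  compText (compText (pairText (pairText (numText n) (pairText (numsText p) (numsText q)))
    Prog.id.toData) pre.toData) (callTwiceText t)

theorem queryText_eq (pre : Prog) (n : ℕ) (p q : List ℕ) (P : Prog) :
    queryText pre (ofNat n) (ofNats p) (ofNats q) P.toData =
      (queryProg pre (cons (ofNat n) (cons (ofNats p) (ofNats q))) P).toData := by
  rw [queryText, numText_ofNat, numsText_ofNats, numsText_ofNats]
  rfl

/-- The numbers from `n` to `2 n - 1`. -/
def upper (n : Data) : Data := map (fun k => append n k) (range n)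

theorem append_ofNat (a b : ℕ) : append (ofNat a) (ofNat b) = ofNat (a + b) := by
  simp [append, ofNat_eq_ofList]

theorem append_ofNats (a b : List ℕ) : append (ofNats a) (ofNats b) = ofNats (a ++ b) := by
  simp [append, ofNats]

theorem upper_ofNat (n : ℕ) : upper (ofNat n) = ofNats ((List.range n).map (n + ·)) := by
  rw [upper, range_ofNat, map_ofNats fun k _ => append_ofNat n k]

/-- The query which belongs to the lists of points `d.hd` and `d.tl`. -/
def queryData (pre : Prog) (R : Polynomial ℕ) (x d : Data) : Data :=
  cons (append x.hd x.hd) (cons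
    (cons (append (upper x.hd) (range x.hd)) (map (fun g => append g (upper x.hd)) x.tl.hd))
    (cons (queryText pre x.hd d.hd d.tl x.tl.tl.hd)
      (append (ofNat (R.eval x.hd.toList.length)) (append x.tl.tl.tl x.tl.tl.tl))))

/-- The first kind of queries. -/
def fixData (i j : Data) : Data :=
  cons (append (range i) (cons i nil)) (append (range i) (cons j (cons j nil)))

/-- The second kind of queries. -/
def mapsData (i j k l : Data) : Data :=
  cons (append (range i) (cons i (cons k nil))) (append (range i) (cons j (cons l nil)))

/-- The list of all queries. -/
def descriptions (n : Data) : Data :=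
  bind (fun i => bind (fun j => cons (fixData i j)
    (bind (fun k => map (fun l => mapsData i j k l) (range n)) (range n))) (range n)) (range n)

/-- The first program of the reduction. -/
def queries (pre : Prog) (R : Polynomial ℕ) (x : Data) : Data :=
  map (fun d => queryData pre R x d) (descriptions x.hd)

/-- The answer in the list `as` to the query with description `d`. -/
def answer (n as d : Data) : Data :=
  pick (fun r => if nth r (descriptions n) = d then nth r as else nil) (range (descriptions n))

/-- The image of `k` under the element that maps `i` to `j`. -/
def image (n as i j k : Data) : Data :=
  (pick (fun l => if answer n as (mapsData i j k l) = nil then nil else cons nil l) (range n)).tl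

/-- The element that maps `i` to `j`, if the answers say that there is just one. -/
def candidate (n as i j : Data) : Data :=
  if i = j then nil else
    if answer n as (fixData i j) = nil then
      if answer n as (mapsData i j i j) = nil then nil else
        cons nil (map (fun k => image n as i j k) (range n))
    else nil

/-- The second program of the reduction. -/
def evaluate (e : Data) : Data :=
  pick (fun i => pick (fun j => candidate e.hd.hd e.tl i j) (range e.hd.hd)) (range e.hd.hd)

end Data

/-! ### Polynomial time for the queries and their evaluation -/

namespace PolyTime

open Data Polynomial

@[fun_prop] theorem listText {l : Data → Data} {F : Data → Data → Data} (hl : PolyTime l)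
    (hF : PolyTime fun e => F e.hd e.tl) : PolyTime fun x => Data.listText (F x) (l x) := by
  obtain ⟨L, hL⟩ := hl.size_le
  obtain ⟨P, hP⟩ := size_le_of_mem hl hF
  have hF' : PolyTime fun e => F e.hd e.tl.hd :=
    hF.comp (g := fun e => .cons e.hd e.tl.hd) (by fun_prop)
  -- Each `pairText` adds `15` nodes, of which the tag `6` takes `13`; the text of `Prog.nil` has
  -- `5`.
  exact foldr (F := fun x a acc => pairText (F x a) acc) hl (const _)
    ((const _).cons (hF'.cons (by fun_prop))) (L * (P + 15) + 5) (fun x m hm => by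
      simp only [eval_add, eval_mul, eval_ofNat]
      have h₁ : m.length ≤ L.eval x.size :=
        (hm.length_le.trans (length_toList_le _)).trans (hL x)
      refine le_trans ?_ (Nat.add_le_add_right (Nat.mul_le_mul_right _ h₁) 5)
      have h₂ : ∀ a ∈ m, (F x a).size ≤ P.eval x.size := fun a ha => hP x a (hm.subset ha)
      clear hm h₁
      induction m with
      | nil => simp [Prog.toData, size]
      | cons a m ih =>
        have h₃ := ih fun b hb => h₂ b (by simp [hb])
        have h₄ := h₂ a (by simp)
        simp only [List.foldr_cons, List.length_cons, add_mul, one_mul]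
        rw [pairText]
        simp only [size, size_ofNat]
        omega)

@[fun_prop] theorem numText {f : Data → Data} (hf : PolyTime f) :
    PolyTime fun x => Data.numText (f x) := by
  unfold Data.numText
  exact .listText hf (by fun_prop)

@[fun_prop] theorem numsText {f : Data → Data} (hf : PolyTime f) :
    PolyTime fun x => Data.numsText (f x) := by
  unfold Data.numsText
  exact .listText hf (by fun_prop)

@[fun_prop] theorem queryText (pre : Prog) {n p q t : Data → Data} (hn : PolyTime n)
    (hp : PolyTime p) (hq : PolyTime q) (ht : PolyTime t) :
    PolyTime fun x => Data.queryText pre (n x) (p x) (q x) (t x) := by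
  unfold Data.queryText callTwiceText compText pairText
  fun_prop

@[fun_prop] theorem upper {n : Data → Data} (hn : PolyTime n) :
    PolyTime fun x => Data.upper (n x) := by
  unfold Data.upper
  exact .map (by fun_prop) (by fun_prop)

@[fun_prop] theorem queryData (pre : Prog) (R : Polynomial ℕ) {x d : Data → Data}
    (hx : PolyTime x) (hd : PolyTime d) :
    PolyTime fun e => Data.queryData pre R (x e) (d e) := by
  unfold Data.queryData
  have h₁ : PolyTime fun e =>
      Data.map (fun g => Data.append g (Data.upper (x e).hd)) (x e).tl.hd :=
    .map (by fun_prop) (by fun_prop)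
  have h₂ : PolyTime fun e => ofNat (R.eval (x e).hd.toList.length) := hx.hd.ofNat_eval R
  fun_prop

@[fun_prop] theorem fixData {i j : Data → Data} (hi : PolyTime i) (hj : PolyTime j) :
    PolyTime fun x => Data.fixData (i x) (j x) := by
  unfold Data.fixData
  fun_prop

@[fun_prop] theorem mapsData {i j k l : Data → Data} (hi : PolyTime i) (hj : PolyTime j)
    (hk : PolyTime k) (hl : PolyTime l) :
    PolyTime fun x => Data.mapsData (i x) (j x) (k x) (l x) := by
  unfold Data.mapsData
  fun_prop

@[fun_prop] theorem descriptions {n : Data → Data} (hn : PolyTime n) :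
    PolyTime fun x => Data.descriptions (n x) := by
  unfold Data.descriptions
  exact .bind (by fun_prop) (.bind (by fun_prop) (.cons (by fun_prop)
    (.bind (by fun_prop) (.map (by fun_prop) (by fun_prop)))))

theorem queries (pre : Prog) (R : Polynomial ℕ) : PolyTime (Data.queries pre R) := by
  unfold Data.queries
  exact .map (by fun_prop) (by fun_prop)

@[fun_prop] theorem answer {n as d : Data → Data} (hn : PolyTime n) (has : PolyTime as)
    (hd : PolyTime d) : PolyTime fun x => Data.answer (n x) (as x) (d x) := by
  unfold Data.answer
  exact .pick (by fun_prop)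
    (.ite_eq (by fun_prop) (by fun_prop) (by fun_prop) (by fun_prop))

@[fun_prop] theorem image {n as i j k : Data → Data} (hn : PolyTime n) (has : PolyTime as)
    (hi : PolyTime i) (hj : PolyTime j) (hk : PolyTime k) :
    PolyTime fun x => Data.image (n x) (as x) (i x) (j x) (k x) := by
  unfold Data.image
  exact .tl (.pick (by fun_prop) (.ite (by fun_prop) (by fun_prop) (by fun_prop)))

@[fun_prop] theorem candidate {n as i j : Data → Data} (hn : PolyTime n) (has : PolyTime as)
    (hi : PolyTime i) (hj : PolyTime j) :
    PolyTime fun x => Data.candidate (n x) (as x) (i x) (j x) := by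
  unfold Data.candidate
  have : PolyTime fun x =>
      Data.map (fun k => Data.image (n x) (as x) (i x) (j x) k) (Data.range (n x)) :=
    .map (by fun_prop) (by fun_prop)
  exact .ite_eq hi hj (by fun_prop) (.ite (by fun_prop)
    (.ite (by fun_prop) (by fun_prop) (by fun_prop)) (by fun_prop))

theorem evaluate : PolyTime Data.evaluate := by
  unfold Data.evaluate
  exact .pick (by fun_prop) (.pick (by fun_prop) (by fun_prop))

end PolyTime


/-! ### The reduction -/

/-- The points less than `i`. -/
def below {n : ℕ} (i : Fin n) : List (Fin n) := (List.finRange n).take i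

theorem mem_below {n : ℕ} {i k : Fin n} : k ∈ below i ↔ k < i := by
  rw [below, List.mem_take_iff_getElem]
  constructor
  · rintro ⟨m, hm, rfl⟩
    simp only [List.length_finRange, lt_inf_iff] at hm
    simpa [Fin.lt_def] using hm.1
  · intro h
    exact ⟨k, by simp [Fin.lt_def.1 h], by simp⟩

theorem length_below {n : ℕ} (i : Fin n) : (below i).length = i := by
  simp [below]

/-- The description of a query of the first kind: can `i` or `j` be fixed together with all points
less than `i`? -/
def fixPair {n : ℕ} (i j : Fin n) : List (Fin n) × List (Fin n) :=
  (below i ++ [i], below i ++ [j, j])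

/-- The description of a query of the second kind: can `i` be mapped to `j`, and `k` to `l`, while
all points less than `i` are fixed? -/
def mapsPair {n : ℕ} (i j k l : Fin n) : List (Fin n) × List (Fin n) :=
  (below i ++ [i, k], below i ++ [j, l])

/-- The list of the descriptions of all queries. -/
def pairs (n : ℕ) : List (List (Fin n) × List (Fin n)) :=
  (List.finRange n).flatMap fun i => (List.finRange n).flatMap fun j =>
    fixPair i j :: (List.finRange n).flatMap fun k => (List.finRange n).map fun l =>
      mapsPair i j k l

theorem fixPair_mem_pairs {n : ℕ} (i j : Fin n) : fixPair i j ∈ pairs n := by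
  simp only [pairs, List.mem_flatMap]
  exact ⟨i, List.mem_finRange i, j, List.mem_finRange j, List.mem_cons_self⟩

theorem mapsPair_mem_pairs {n : ℕ} (i j k l : Fin n) : mapsPair i j k l ∈ pairs n := by
  simp only [pairs, List.mem_flatMap]
  refine ⟨i, List.mem_finRange i, j, List.mem_finRange j, List.mem_cons_of_mem _ ?_⟩
  simp only [List.mem_flatMap, List.mem_map]
  exact ⟨k, List.mem_finRange k, l, List.mem_finRange l, rfl⟩

/-- In degree `0` there are no queries at all, so the exceptional case of `exists_hides_query` never
occurs. -/
theorem length_le_of_mem_pairs {n : ℕ} {d : List (Fin n) × List (Fin n)} (h : d ∈ pairs n) :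
    0 < n ∧ d.1.length ≤ n + 2 ∧ d.2.length ≤ n + 2 := by
  simp only [pairs, List.mem_flatMap, List.mem_cons, List.mem_map] at h
  obtain ⟨i, -, j, -, rfl | ⟨k, -, l, -, rfl⟩⟩ := h
  all_goals
    have := i.2
    simp only [fixPair, mapsPair, List.length_append, length_below, List.length_cons,
      List.length_nil]
    omega

namespace Data

/-- Pairs of lists of points. -/
def ofPair {n : ℕ} (d : List (Fin n) × List (Fin n)) : Data :=
  cons (ofPoints d.1) (ofPoints d.2)

theorem ofPair_injective {n : ℕ} : Function.Injective (ofPair (n := n)) := fun a b h => by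
  simp only [ofPair, cons.injEq, ofPoints_injective.eq_iff] at h
  exact Prod.ext h.1 h.2

theorem append_ofPoints {n : ℕ} (p q : List (Fin n)) :
    append (ofPoints p) (ofPoints q) = ofPoints (p ++ q) := by
  simp only [ofPoints, append_ofNats, List.map_append]

theorem range_coe {n : ℕ} (i : Fin n) : range (ofNat i) = ofPoints (below i) := by
  rw [range_ofNat, ofPoints, below, List.map_take, List.map_coe_finRange_eq_range,
    List.take_range, min_eq_left i.2.le]

theorem fixData_coe {n : ℕ} (i j : Fin n) :
    fixData (ofNat i) (ofNat j) = ofPair (fixPair i j) := by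
  rw [fixData, range_coe]
  change cons (append _ (ofPoints [i])) (append _ (ofPoints [j, j])) = _
  rw [append_ofPoints, append_ofPoints]
  rfl

theorem mapsData_coe {n : ℕ} (i j k l : Fin n) :
    mapsData (ofNat i) (ofNat j) (ofNat k) (ofNat l) = ofPair (mapsPair i j k l) := by
  rw [mapsData, range_coe]
  change cons (append _ (ofPoints [i, k])) (append _ (ofPoints [j, l])) = _
  rw [append_ofPoints, append_ofPoints]
  rfl

theorem map_range {n : ℕ} (F : Data → Data) :
    map F (range (ofNat n)) = ofList ((List.finRange n).map fun i : Fin n => F (ofNat i)) := by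
  rw [range_ofNat, ofNats_range, map, toList_ofPoints, List.map_map]
  rfl

theorem bind_range {n : ℕ} {F : Data → Data} {G : Fin n → List Data}
    (h : ∀ i : Fin n, F (ofNat i) = ofList (G i)) :
    bind F (range (ofNat n)) = ofList ((List.finRange n).flatMap G) := by
  rw [range_ofNat, ofNats_range, bind, toList_ofPoints, List.flatMap_map]
  simp only [h, toList_ofList]

theorem descriptions_ofNat (n : ℕ) :
    descriptions (ofNat n) = ofList ((pairs n).map ofPair) := by
  rw [descriptions, pairs]
  simp only [List.map_flatMap, List.map_cons, List.map_map]
  refine bind_range fun i => bind_range fun j => ?_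
  rw [fixData_coe, ofList]
  congr 1
  refine bind_range fun k => ?_
  rw [map_range]
  simp only [mapsData_coe]
  rfl

theorem queryData_encode (pre : Prog) (R : Polynomial ℕ) (I : HSInstance)
    (d : List (Fin I.n) × List (Fin I.n)) :
    queryData pre R I.encode (ofPair d) = (query pre R I d.1 d.2).encode := by
  have h₁ : append (upper (ofNat I.n)) (range (ofNat I.n)) =
      ofPerm (wreath (1 : Equiv.Perm (Fin I.n)) 1 true) := by
    rw [ofPerm_wreath_true, upper_ofNat, range_ofNat, append_ofNats]
    simp [List.ofFn_eq_map]
  have h₂ : ∀ g : Equiv.Perm (Fin I.n), append (ofPerm g) (upper (ofNat I.n)) =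
      ofPerm (wreath g 1 false) := by
    intro g
    rw [ofPerm_wreath_false, upper_ofNat, ofPerm_eq, append_ofNats]
    simp [List.ofFn_eq_map]
  have h₃ : map (fun g => append g (upper (ofNat I.n))) (ofList (I.gens.map ofPerm)) =
      ofList ((I.gens.map fun g => wreath g 1 false).map ofPerm) := by
    simp only [map, toList_ofList, List.map_map]
    congr 1
    exact List.map_congr_left fun g _ => h₂ g
  simp only [queryData, HSInstance.encode, hd_cons, tl_cons, ofPair, append_ofNat, h₁, h₃,
    toList_ofNat, List.length_replicate]
  rw [ofPoints, ofPoints, queryText_eq]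
  rfl

theorem queries_encode (pre : Prog) (R : Polynomial ℕ) (I : HSInstance) :
    queries pre R I.encode = ofList
      (((pairs I.n).map fun d => query pre R I d.1 d.2).map HSInstance.encode) := by
  have : I.encode.hd = ofNat I.n := rfl
  rw [queries, this, descriptions_ofNat, map, toList_ofList, List.map_map, List.map_map]
  congr 1
  exact List.map_congr_left fun d _ => queryData_encode pre R I d

/-- Answers are looked up by description. No uniqueness of the position is needed, as the truth of
an answer depends on the description alone. -/
theorem answer_eq_nil_iff {n : ℕ} {T : List (Fin n) × List (Fin n) → Prop} {as : List Data}
    (h : List.Forall₂ (fun d a => a ≠ nil ↔ T d) (pairs n) as)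
    {d : List (Fin n) × List (Fin n)} (hd : d ∈ pairs n) :
    answer (ofNat n) (ofList as) (ofPair d) = nil ↔ ¬ T d := by
  obtain ⟨hlen, h⟩ := List.forall₂_iff_get.1 h
  have key := pick_spec (fun r => if nth r (descriptions (ofNat n)) = ofPair d then
    nth r (ofList as) else nil) (range (descriptions (ofNat n)))
  rw [answer]
  simp only [range, descriptions_ofNat, toList_ofList, List.length_map, List.mem_map,
    List.mem_range, forall_exists_index, and_imp, forall_apply_eq_imp_iff₂,
    exists_exists_and_eq_and] at key ⊢
  rcases key with ⟨h₀, h₁⟩ | ⟨h₀, r, hr, h₁⟩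
  · refine iff_of_true h₀ fun hT => ?_
    obtain ⟨r, hr, rfl⟩ := List.getElem_of_mem hd
    have := h₁ r hr
    rw [nth_ofList (by simpa using hr), nth_ofList (hlen ▸ hr), List.getElem_map,
      if_pos rfl] at this
    exact (h r hr (hlen ▸ hr)).2 hT this
  · refine iff_of_false h₀ (not_not.2 ?_)
    rw [h₁, nth_ofList (by simpa using hr), nth_ofList (hlen ▸ hr), List.getElem_map] at h₀
    split_ifs at h₀ with h₂
    · rw [← ofPair_injective h₂]
      exact (h r hr (hlen ▸ hr)).1 h₀
    · exact absurd rfl h₀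

end Data

/-- The answer to the query about `d`, for a group `H` of permutations. -/
def Linked {n : ℕ} {G : Subgroup (Equiv.Perm (Fin n))} (H : Subgroup G)
    (d : List (Fin n) × List (Fin n)) : Prop :=
  (∃ h ∈ H, h ≠ 1 ∧ d.1.map h.1 = d.1) ∨ (∃ h ∈ H, h ≠ 1 ∧ d.2.map h.1 = d.2) ∨
    ∃ h ∈ H, d.1.map h.1 = d.2

/-! ### Pointwise stabilizers and determination of an element -/

section Linked

variable {n : ℕ} {G : Subgroup (Equiv.Perm (Fin n))} {H : Subgroup G} {i j : Fin n}

theorem map_below_append {g : Equiv.Perm (Fin n)} {p q : List (Fin n)} :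
    (below i ++ p).map g = below i ++ q ↔ (∀ k < i, g k = k) ∧ p.map g = q := by
  have h : (below i).map g = below i ↔ ∀ k < i, g k = k := by
    conv_lhs => rw [← List.map_id (below i), List.map_map]
    rw [List.map_inj_left]
    simp [mem_below]
  rw [← h, List.map_append]
  constructor
  · exact fun e => List.append_inj e (List.length_map _)
  · rintro ⟨h₁, h₂⟩
    rw [h₁, h₂]

/-- The repetition of `j` gives the two lists different lengths, so nothing maps one to the other
and the third alternative of `Linked` drops out. -/
theorem linked_fixPair : Linked H (fixPair i j) ↔
    (∃ h ∈ H, h ≠ 1 ∧ (∀ k < i, h.1 k = k) ∧ h.1 i = i) ∨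
      ∃ h ∈ H, h ≠ 1 ∧ (∀ k < i, h.1 k = k) ∧ h.1 j = j := by
  simp only [Linked, fixPair, map_below_append, List.map_cons, List.map_nil, List.cons.injEq,
    and_true, reduceCtorEq, and_false, exists_false, or_false, and_self]

/-- An element fixing either list pointwise would fix `i` or `j` as well as the points less than
`i`; by hypothesis it is trivial, and only the third alternative survives. -/
theorem linked_mapsPair (hi : ¬ Linked H (fixPair i j)) {k l : Fin n} :
    Linked H (mapsPair i j k l) ↔
      ∃ h ∈ H, (∀ m < i, h.1 m = m) ∧ h.1 i = j ∧ h.1 k = l := by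
  rw [linked_fixPair] at hi
  simp only [Linked, mapsPair, map_below_append, List.map_cons, List.map_nil, List.cons.injEq,
    and_true]
  constructor
  · rintro (⟨h, hh, h1, hb, hk, -⟩ | ⟨h, hh, h1, hb, hk, -⟩ | h)
    · exact absurd (Or.inl ⟨h, hh, h1, hb, hk⟩) hi
    · exact absurd (Or.inr ⟨h, hh, h1, hb, hk⟩) hi
    · exact h
  · exact fun h => Or.inr (Or.inr h)

/-- The quotient `g⁻¹ * h` fixes `i` and all points less than `i`, hence is trivial. -/
theorem eq_of_not_linked (hi : ¬ Linked H (fixPair i j)) {g h : G} (hg : g ∈ H) (hh : h ∈ H)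
    (hgi : ∀ m < i, g.1 m = m) (hhi : ∀ m < i, h.1 m = m) (hgj : g.1 i = j) (hhj : h.1 i = j) :
    g = h := by
  rw [linked_fixPair] at hi
  by_contra hne
  refine hi (Or.inl ⟨g⁻¹ * h, H.mul_mem (H.inv_mem hg) hh, fun h₁ => hne (inv_mul_eq_one.1 h₁),
    fun m hm => ?_, ?_⟩)
  · change g.1⁻¹ (h.1 m) = m
    rw [hhi m hm, Equiv.Perm.inv_eq_iff_eq, hgi m hm]
  · change g.1⁻¹ (h.1 i) = i
    rw [hhj, Equiv.Perm.inv_eq_iff_eq, hgj]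

theorem exists_not_linked (hH : H ≠ ⊥) : ∃ i j : Fin n, i ≠ j ∧ ¬ Linked H (fixPair i j) ∧
    Linked H (mapsPair i j i j) := by
  let P : ℕ → Prop := fun m => ∃ h ∈ H, h ≠ 1 ∧ ∀ k : Fin n, k < m → h.1 k = k
  have hP0 : P 0 := by
    obtain ⟨h, hh⟩ := Subgroup.ne_bot_iff_exists_ne_one.1 hH
    exact ⟨h, h.2, fun e => hh (Subtype.ext e), fun k hk => absurd hk (by omega)⟩
  have hPn : ¬ P n := by
    rintro ⟨h, -, h1, hfix⟩
    exact h1 (Subtype.ext (Equiv.ext fun k => hfix k k.2))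
  -- The chain of stabilizers starts at `H` and ends at the trivial group; `m` is a place where it
  -- becomes trivial.
  obtain ⟨m, hm, hm'⟩ : ∃ m, P m ∧ ¬ P (m + 1) := by
    by_contra! hcon
    exact hPn (Nat.rec hP0 hcon n)
  obtain ⟨h, hh, h1, hfix⟩ := hm
  have hmn : m < n := by
    by_contra hmn
    exact hPn ⟨h, hh, h1, fun k _ => hfix k (by omega)⟩
  have hstab : ¬ ∃ g ∈ H, g ≠ 1 ∧ (∀ k < (⟨m, hmn⟩ : Fin n), g.1 k = k) ∧
      g.1 ⟨m, hmn⟩ = ⟨m, hmn⟩ := by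
    rintro ⟨g, hg, g1, hgfix, hgm⟩
    refine hm' ⟨g, hg, g1, fun k hk => ?_⟩
    rcases Nat.lt_succ_iff_lt_or_eq.1 hk with hk | hk
    · exact hgfix k hk
    · obtain rfl : k = ⟨m, hmn⟩ := Fin.ext hk
      exact hgm
  have hlink : ¬ Linked H (fixPair ⟨m, hmn⟩ (h.1 ⟨m, hmn⟩)) := by
    rw [linked_fixPair, or_iff_right hstab]
    rintro ⟨g, hg, g1, hgfix, hgm⟩
    -- Conjugation by `h` carries a nontrivial element fixing `h i` to one fixing `i`; since `h`
    -- fixes the points less than `i`, these stay fixed.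
    refine hstab ⟨h⁻¹ * g * h, H.mul_mem (H.mul_mem (H.inv_mem hh) hg) hh, fun e => g1 ?_,
      fun k hk => ?_, ?_⟩
    · rwa [mul_assoc, inv_mul_eq_one, eq_comm, mul_eq_right] at e
    · change h.1⁻¹ (g.1 (h.1 k)) = k
      rw [hfix k hk, hgfix k hk, Equiv.Perm.inv_eq_iff_eq, hfix k hk]
    · change h.1⁻¹ (g.1 (h.1 _)) = _
      rw [hgm, Equiv.Perm.inv_eq_iff_eq]
  refine ⟨⟨m, hmn⟩, h.1 ⟨m, hmn⟩, fun e => ?_, hlink, ?_⟩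
  · exact hstab ⟨h, hh, h1, fun k hk => hfix k hk, e.symm⟩
  · exact (linked_mapsPair hlink).2 ⟨h, hh, fun k hk => hfix k hk, rfl, rfl⟩

end Linked

/-- Every pair `(i, j)` that passes the tests yields a correct element (`hcand`), not only the one
from `exists_not_linked`; the latter is needed to know that some pair passes if `H ≠ ⊥`. -/
theorem evaluate_spec {I : HSInstance} {H : Subgroup I.group} {as : List Data}
    (h : List.Forall₂ (fun d a => a ≠ .nil ↔ Linked H d) (pairs I.n) as) :
    (∃ h ∈ H, h ≠ 1 ∧
      Data.evaluate (.cons I.encode (.ofList as)) = .cons .nil (Data.ofPerm h.1)) ∨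
      (H = ⊥ ∧ Data.evaluate (.cons I.encode (.ofList as)) = .nil) := by
  have hans := fun d hd => Data.answer_eq_nil_iff h (d := d) hd
  have hn : I.encode.hd = .ofNat I.n := rfl
  have hfix : ∀ i j : Fin I.n, Data.answer (.ofNat I.n) (.ofList as)
      (Data.fixData (.ofNat i) (.ofNat j)) = .nil ↔ ¬ Linked H (fixPair i j) := fun i j => by
    rw [Data.fixData_coe, hans _ (fixPair_mem_pairs i j)]
  have hmaps : ∀ i j k l : Fin I.n, Data.answer (.ofNat I.n) (.ofList as)
      (Data.mapsData (.ofNat i) (.ofNat j) (.ofNat k) (.ofNat l)) = .nil ↔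
        ¬ Linked H (mapsPair i j k l) := fun i j k l => by
    rw [Data.mapsData_coe, hans _ (mapsPair_mem_pairs i j k l)]
  have hcoe : ∀ i j : Fin I.n, Data.ofNat i = Data.ofNat j ↔ i = j := fun i j => by
    rw [Data.ofNat_injective.eq_iff, Fin.val_inj]
  have hcand : ∀ i j : Fin I.n, i ≠ j → ¬ Linked H (fixPair i j) →
      Linked H (mapsPair i j i j) → ∃ h ∈ H, h ≠ 1 ∧
        Data.candidate (.ofNat I.n) (.ofList as) (.ofNat i) (.ofNat j) =
          .cons .nil (Data.ofPerm h.1) := by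
    intro i j hij hf hm
    obtain ⟨g, hg, hgb, hgi, -⟩ := (linked_mapsPair hf).1 hm
    refine ⟨g, hg, fun e => hij ?_, ?_⟩
    · rw [← hgi, e]
      rfl
    rw [Data.candidate, if_neg (by rwa [hcoe]), if_pos ((hfix i j).2 hf),
      if_neg (by rw [hmaps]; exact not_not.2 hm), Data.range_ofNat, Data.ofNats_range,
      Data.ofPerm_eq_ofPoints]
    congr 1
    refine Data.map_ofPoints fun k _ => ?_
    -- The value `l = g k` gets a positive answer, so the search succeeds; by uniqueness of `g`, any
    -- `l` that it returns equals `g k`.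
    have key := Data.pick_spec (fun l => if Data.answer (.ofNat I.n) (.ofList as)
      (Data.mapsData (.ofNat i) (.ofNat j) (.ofNat k) l) = .nil then .nil else .cons .nil l)
      (Data.ofPoints (List.finRange I.n))
    rw [Data.image, Data.range_ofNat, Data.ofNats_range]
    simp only [Data.toList_ofPoints, List.mem_map, List.mem_finRange, true_and,
      forall_exists_index, forall_apply_eq_imp_iff, hmaps, exists_exists_eq_and] at key
    rcases key with ⟨-, h₁⟩ | ⟨h₀, l, h₁⟩
    · have := h₁ (g.1 k)
      rw [if_neg fun e =>
        (hmaps i j k (g.1 k)).1 e ((linked_mapsPair hf).2 ⟨g, hg, hgb, hgi, rfl⟩)] at this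
      cases this
    · rw [h₁] at h₀ ⊢
      split_ifs at h₀ ⊢ with h₂
      · exact absurd rfl h₀
      · obtain ⟨g', hg', hgb', hgi', rfl⟩ := (linked_mapsPair hf).1
          (not_not.1 fun e => h₂ ((hmaps i j k l).2 e))
        rw [eq_of_not_linked hf hg' hg hgb' hgb hgi' hgi]
        rfl
  have hnil : ∀ i j : Fin I.n,
      Data.candidate (.ofNat I.n) (.ofList as) (.ofNat i) (.ofNat j) ≠ .nil →
        i ≠ j ∧ ¬ Linked H (fixPair i j) ∧ Linked H (mapsPair i j i j) := by
    intro i j hc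
    rw [Data.candidate] at hc
    split_ifs at hc with h₁ h₂ h₃
    · exact absurd rfl hc
    · exact absurd rfl hc
    · exact ⟨fun e => h₁ (e ▸ rfl), (hfix i j).1 h₂, not_not.1 fun e => h₃ ((hmaps i j i j).2 e)⟩
    · exact absurd rfl hc
  have hinner := fun i : Fin I.n => Data.pick_spec
    (fun j => Data.candidate (.ofNat I.n) (.ofList as) (.ofNat i) j)
    (Data.ofPoints (List.finRange I.n))
  have houter := Data.pick_spec (fun i => Data.pick
    (fun j => Data.candidate (.ofNat I.n) (.ofList as) i j) (Data.ofPoints (List.finRange I.n)))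
    (Data.ofPoints (List.finRange I.n))
  rw [Data.evaluate]
  simp only [Data.hd_cons, Data.tl_cons, hn, Data.range_ofNat, Data.ofNats_range,
    Data.toList_ofPoints, List.mem_map, List.mem_finRange, true_and, forall_exists_index,
    forall_apply_eq_imp_iff, exists_exists_eq_and] at hinner houter ⊢
  rcases houter with ⟨h₀, h₁⟩ | ⟨h₀, i, h₁⟩
  · refine Or.inr ⟨?_, h₀⟩
    by_contra hH
    obtain ⟨i, j, hij, hf, hm⟩ := exists_not_linked hH
    obtain ⟨g, -, -, hg⟩ := hcand i j hij hf hm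
    rcases hinner i with ⟨-, h₂⟩ | ⟨h₂, -⟩
    · rw [h₂ j] at hg
      cases hg
    · exact h₂ (h₁ i)
  · rcases hinner i with ⟨h₂, -⟩ | ⟨h₂, j, h₃⟩
    · exact absurd (h₁.trans h₂) h₀
    · obtain ⟨hij, hf, hm⟩ := hnil i j (h₃ ▸ h₂)
      obtain ⟨g, hg, g1, hgc⟩ := hcand i j hij hf hm
      exact Or.inl ⟨g, hg, g1, by rw [h₁, h₃, hgc]⟩

/-! ### The theorem -/

theorem truthTableReducible_of_polyTime {A B : Problem} {Q E : Data → Data} (hQ : PolyTime Q)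
    (hE : PolyTime E)
    (h : ∀ (φ : BlackBox) (x : A.Instance), A.Promise φ x → ∃ ys : List B.Instance,
      (∀ y ∈ ys, B.Promise φ y) ∧ Q (A.encode x) = .ofList (ys.map B.encode) ∧
      ∀ as : List Data, List.Forall₂ (B.IsAnswer φ) ys as →
        A.IsAnswer φ x (E (.cons (A.encode x) (.ofList as)))) :
    TruthTableReducible A B := by
  obtain ⟨q, P, hq⟩ := hQ
  obtain ⟨e, R, he⟩ := hE
  refine ⟨q, e, P + R, fun φ x hx => ?_⟩
  obtain ⟨ys, hys, hQx, has⟩ := h φ x hx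
  refine ⟨ys, hys, ?_, fun as ha => ⟨_, has as ha, ?_⟩⟩
  · rw [← hQx]
    exact (hq φ _).mono (by simp)
  · exact (he φ _).mono (by simp)

theorem decision_reducible_search (s : Side) :
    TruthTableReducible (HiddenSubgroupD s) (HiddenSubgroupS s) := by
  refine truthTableReducible_of_polyTime (Q := fun x => .cons x .nil)
    (E := fun e => if e.tl.hd = .nil then .nil else .yes) (by fun_prop)
    (.ite (by fun_prop) (by fun_prop) (by fun_prop)) fun φ I hI => ?_
  refine ⟨[I], fun y hy => List.mem_singleton.1 hy ▸ hI, rfl, fun as has => ?_⟩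
  obtain ⟨a, as, ⟨H, hH, ha⟩, hnil, rfl⟩ := List.forall₂_cons_left_iff.1 has
  refine ⟨H, hH, ?_⟩
  rcases ha with ⟨h, hh, h1, rfl⟩ | ⟨rfl, rfl⟩
  · refine Or.inl ⟨?_, rfl⟩
    rintro rfl
    exact h1 (Subgroup.mem_bot.1 hh)
  · exact Or.inr ⟨rfl, rfl⟩

theorem search_reducible_decision (s : Side) :
    TruthTableReducible (HiddenSubgroupS s) (HiddenSubgroupD s) := by
  obtain ⟨pre, R, hpre⟩ := exists_prepares s
  refine truthTableReducible_of_polyTime (PolyTime.queries pre R) PolyTime.evaluate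
    fun φ (I : HSInstance) hI => ?_
  obtain ⟨H, hH⟩ : ∃ H, Hides s φ I H := hI
  have hquery : ∀ d ∈ pairs I.n, ∃ H', Hides s φ (query pre R I d.1 d.2) H' ∧
      (H' ≠ ⊥ ↔ Linked H d) := by
    intro d hd
    obtain ⟨hn, h₁, h₂⟩ := length_le_of_mem_pairs hd
    obtain ⟨H', hH', h⟩ := exists_hides_query hpre hH h₁ h₂
    exact ⟨H', hH', h hn⟩
  let ys : List HSInstance := (pairs I.n).map fun d => query pre R I d.1 d.2
  refine ⟨ys, ?_, Data.queries_encode pre R I,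
    fun as has => ⟨H, hH, evaluate_spec ?_⟩⟩
  · intro y hy
    obtain ⟨d, hd, rfl⟩ := List.mem_map.1 hy
    obtain ⟨H', hH', -⟩ := hquery d hd
    exact ⟨H', hH'⟩
  · replace has : List.Forall₂ (fun d a => (HiddenSubgroupD s).IsAnswer φ (query pre R I d.1 d.2) a)
        (pairs I.n) as := List.forall₂_map_left_iff.1 has
    obtain ⟨hlen, has⟩ := List.forall₂_iff_get.1 has
    refine List.forall₂_iff_get.2 ⟨hlen, fun r h₁ h₂ => ?_⟩
    -- The given answer refers to some hidden subgroup `H''`, which has to be identified with the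
    -- constructed `H'`.
    obtain ⟨H', hH', hd⟩ := hquery _ (List.get_mem (pairs I.n) ⟨r, h₁⟩)
    obtain ⟨H'', hH'', ha⟩ := has r h₁ h₂
    obtain rfl := hH'.unique hH''
    rw [← hd]
    rcases ha with ⟨h₃, h₄⟩ | ⟨h₃, h₄⟩
    · exact iff_of_true (by rw [h₄]; simp [Data.yes]) h₃
    · exact iff_of_false (not_not.2 h₄) (not_not.2 h₃)

end HSP

theorem mainTheorem7 (s : HSP.Side) :
    HSP.PolyTimeEquivalent (HSP.HiddenSubgroupD s) (HSP.HiddenSubgroupS s) :=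
  ⟨HSP.decision_reducible_search s, HSP.search_reducible_decision s⟩
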